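/- Let $g\ge 1$, let $p(x)=\sum_{k=0}^n a_kx^{n-k}$ be a complex polynomial of degree $n=2g+1$ or $n=2g+2$ ($a_0\neq 0$) without multiple zeros, and let $X$ be the compact Riemann surface of genus $g$ that completes the curve $y^2=p(x)$ (with two points over $x=\infty$ if $n$ is even, and one if $n$ is odd). Let $c,\langle 1\rangle\in\mathbb C$. A *Virasoro one-point function* on $X$ of central charge $c$ and zero-point function $\langle 1\rangle$ assigns to every local holomorphic coordinate $z$ on $X$ a holomorphic function $\langle T(z)\rangle$ such that, under every change of coordinate $z\mapsto\hat z(z)$, $$\langle \hat T(\hat z)\rangle\,[\hat z'(z)]^2=\langle T(z)\rangle-\frac{c}{12}S(\hat z)\langle 1\rangle,\qquad S(f)=\frac{f'''}{f'}-\frac{3[f'']^2}{2[f']^2}.$$ We write $\langle T(x)\rangle$ for its expression in the coordinate $x$, a function on the part $y\ne0$ of the affine curve. 1. If $n$ is even, then $\langle T(x)\rangle=O(x^{-4})$ as $x\to\infty$ on $X$; more precisely, $x^4\langle T(x)\rangle$ has a finite limit at each of the two points over $x=\infty$, and for all $c$ and $\langle 1\rangle$ there is a one-point function for which both limits are nonzero.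 If $n$ is odd, then as $x\to\infty$ $$\langle T(x)\rangle=\frac{c}{32}x^{-2}\langle 1\rangle+O(x^{-3}).$$ 2. For every Virasoro one-point function there is a polynomial $P(x,y)=P^{(\text{G-even})}(x)+yP^{(\text{G-odd})}(x)$ with $$p\langle T(x)\rangle=\frac{c}{32}\frac{[p']^2}{p}\langle 1\rangle+\frac14P(x,y),$$ where $P^{(\text{G-even})}$ is a polynomial of degree at most $n-2$, with equality if $c\langle 1\rangle\ne 0$, such that: (a) if $n$ is even, then $P^{(\text{G-even})}+\frac c8\frac{[p']^2}{p}\langle 1\rangle=O(x^{n-4})$ as $x\to\infty$; (b) if $n$ is odd, then $P^{(\text{G-even})}+\frac c8(n^2-1)a_0x^{n-2}\langle 1\rangle$ has no terms of degree larger than $n-3$. If $g\ge3$, then $P^{(\text{G-odd})}$ is a polynomial of degree at most $\frac n2-4$ if $n$ is even and at most $\frac{n-1}2-3$ if $n$ is odd, and for all $c$ and $\langle 1\rangle$ there is a one-point function for which the degree equals this bound. If $g\le2$, then $P^{(\text{G-odd})}=0$. 3. Let $g\ge2$. For fixed $c$ and $\langle 1\rangle$, the functions $\langle T(x)\rangle$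 form a nonempty complex affine space of dimension $3(g-1)$. -/

import Mathlib

open Polynomial Filter Topology Asymptotics
open scoped Manifold ContDiff

noncomputable section

/-! ### The principal square root -/

theorem csqrt_sq (z : ℂ) : z.sqrt ^ 2 = z := by
  simp [Complex.sqrt]

theorem sq_mem_slitPlane {v : ℂ} (hv : 0 < v.re) : v ^ 2 ∈ Complex.slitPlane := by
  rw [Complex.mem_slitPlane_iff]
  by_cases h : v.im = 0
  · left
    simp only [sq, Complex.mul_re, h]
    nlinarith
  · right
    simp only [sq, Complex.mul_im]
    intro h2
    apply h
    nlinarith [mul_self_pos.2 h, mul_pos hv hv,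
      (by nlinarith : v.re * v.im = 0), mul_eq_zero.1 (by nlinarith : v.re * v.im = 0)]

theorem csqrt_re_nonneg (z : ℂ) : 0 ≤ z.sqrt.re := by
  rw [Complex.sqrt, Complex.cpow_inv_two_re]
  exact Real.sqrt_nonneg _

theorem csqrt_re_pos {z : ℂ} (hz : z ∈ Complex.slitPlane) : 0 < z.sqrt.re := by
  rw [Complex.sqrt, Complex.cpow_inv_two_re]
  apply Real.sqrt_pos.2
  rcases Complex.mem_slitPlane_iff.1 hz with h | h
  · have := norm_nonneg z
    linarith
  · have := neg_lt_of_abs_lt (Complex.abs_re_lt_norm.2 h)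
    linarith

theorem csqrt_of_sq {v : ℂ} (hv : 0 < v.re) : (v ^ 2).sqrt = v := by
  rcases sq_eq_sq_iff_eq_or_eq_neg.1 (csqrt_sq (v ^ 2)) with h | h
  · exact h
  · have := csqrt_re_nonneg (v ^ 2)
    rw [h, Complex.neg_re] at this
    linarith

/-! ### Plane curves `y ^ 2 = f x` and their coordinate charts -/

/-- The plane affine curve `y ^ 2 = f x`. -/
@[ext] structure AffineCurve (f : ℂ[X]) where
  /-- The coordinate `x`. -/
  x : ℂ
  /-- The coordinate `y`. -/
  y : ℂ
  y_sq : y ^ 2 = f.eval x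

namespace AffineCurve

variable {f : ℂ[X]}

/-- The pair of coordinates `(x, y)`. -/
def coords (P : AffineCurve f) : ℂ × ℂ := (P.x, P.y)

theorem ext_coords {P Q : AffineCurve f} (h : P.coords = Q.coords) : P = Q :=
  AffineCurve.ext (congrArg Prod.fst h) (congrArg Prod.snd h)

/-- A point with prescribed coordinate `x`. -/
def lift (f : ℂ[X]) (t : ℂ) : AffineCurve f := ⟨t, (f.eval t).sqrt, csqrt_sq _⟩

instance : Nonempty (AffineCurve f) := ⟨lift f 0⟩

/-- The chart with coordinate `x`, on the part of the curve where `y / b` lies in the right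
half plane. Its inverse is `x ↦ (x, b √(f x / b ^ 2))`. -/
def xChart (f : ℂ[X]) (b : ℂ) (hb : b ≠ 0) : PartialEquiv (AffineCurve f) ℂ where
  toFun P := P.x
  invFun t := ⟨t, b * (f.eval t / b ^ 2).sqrt, by
    simp only [mul_pow, csqrt_sq]
    field_simp⟩
  source := {P | 0 < (P.y / b).re}
  target := {t | f.eval t / b ^ 2 ∈ Complex.slitPlane}
  map_source' := by
    intro P hP
    have := sq_mem_slitPlane hP
    rwa [div_pow, P.y_sq] at this
  map_target' := by
    intro t ht
    have := csqrt_re_pos ht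
    change 0 < (b * (f.eval t / b ^ 2).sqrt / b).re
    rwa [mul_div_cancel_left₀ _ hb]
  left_inv' := by
    intro P hP
    refine AffineCurve.ext rfl ?_
    change b * (f.eval P.x / b ^ 2).sqrt = P.y
    rw [← P.y_sq, ← div_pow, csqrt_of_sq hP]
    field_simp
  right_inv' := by
    intro t _
    rfl

open Classical in
/-- The chart with coordinate `y`, on the part of the curve where `x` lies in a set `O` on
which `f` is injective. -/
def yChart (f : ℂ[X]) (O : Set ℂ) (hinj : O.InjOn (fun t => f.eval t)) :
    PartialEquiv (AffineCurve f) ℂ where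
  toFun P := P.y
  invFun t :=
    if h : ∃ s ∈ O, f.eval s = t ^ 2 then
      ⟨Function.invFunOn (fun s => f.eval s) O (t ^ 2), t, (Function.invFunOn_eq h).symm⟩
    else lift f 0
  source := {P | P.x ∈ O}
  target := {t | ∃ s ∈ O, f.eval s = t ^ 2}
  map_source' := by
    intro P hP
    exact ⟨P.x, hP, P.y_sq.symm⟩
  map_target' := by
    intro t ht
    have ht' : ∃ s ∈ O, f.eval s = t ^ 2 := ht
    rw [dif_pos ht']
    exact Function.invFunOn_mem ht'
  left_inv' := by
    intro P hP
    have hP' : ∃ s ∈ O, f.eval s = P.y ^ 2 := ⟨P.x, hP, P.y_sq.symm⟩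
    rw [dif_pos hP']
    refine AffineCurve.ext ?_ rfl
    refine hinj (Function.invFunOn_mem hP') hP ?_
    exact (Function.invFunOn_eq hP').trans P.y_sq
  right_inv' := by
    intro t ht
    have ht' : ∃ s ∈ O, f.eval s = t ^ 2 := ht
    rw [dif_pos ht']

/-- The charts of the affine curve: `x` is used as coordinate away from `y = 0`, and `y` is used as
coordinate over open sets on which `f` is injective with nowhere vanishing derivative. -/
def charts (f : ℂ[X]) : Set (PartialEquiv (AffineCurve f) ℂ) :=
  {e | (∃ b hb, e = xChart f b hb) ∨
    ∃ O hinj, IsOpen O ∧ (∀ a ∈ O, f.derivative.eval a ≠ 0) ∧ e = yChart f O hinj}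

theorem exists_injOn {a : ℂ} (ha : f.derivative.eval a ≠ 0) :
    ∃ O : Set ℂ, a ∈ O ∧ IsOpen O ∧ O.InjOn (fun t => f.eval t) ∧
      ∀ s ∈ O, f.derivative.eval s ≠ 0 := by
  have hd : HasStrictDerivAt (fun t => f.eval t) (f.derivative.eval a) a := f.hasStrictDerivAt a
  set E := (hd.hasStrictFDerivAt_equiv ha).toOpenPartialHomeomorph (fun t => f.eval t) with hE
  refine ⟨E.source ∩ {s | f.derivative.eval s ≠ 0},
    ⟨(hd.hasStrictFDerivAt_equiv ha).mem_toOpenPartialHomeomorph_source, ha⟩,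
    E.open_source.inter (isOpen_ne_fun f.derivative.continuous continuous_const), ?_,
    fun s hs => hs.2⟩
  exact E.injOn.mono Set.inter_subset_left

theorem exists_chart (hf : ∀ a, f.eval a = 0 → f.derivative.eval a ≠ 0) (P : AffineCurve f) : ∃ e ∈ charts f, P ∈ e.source := by
  by_cases h : P.y = 0
  · have h0 : f.eval P.x = 0 := by rw [← P.y_sq, h]; simp
    have h1 : f.derivative.eval P.x ≠ 0 := hf _ h0
    obtain ⟨O, hP, hO, hinj, hd⟩ := exists_injOn h1
    exact ⟨yChart f O hinj, Or.inr ⟨O, hinj, hO, hd, rfl⟩, hP⟩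
  · refine ⟨xChart f P.y h, Or.inl ⟨_, h, rfl⟩, ?_⟩
    change 0 < (P.y / P.y).re
    rw [div_self h]
    simp

/-- Holomorphy of a chart relative to the ambient plane. -/
structure Nice (e : PartialEquiv (AffineCurve f) ℂ) : Prop where
  open_target : IsOpen e.target
  diff : DifferentiableOn ℂ (fun z => (e.symm z).coords) e.target
  src : ∃ O : Set (ℂ × ℂ), IsOpen O ∧ e.source = {P | P.coords ∈ O}
  fwd : ∃ k : ℂ × ℂ → ℂ, Differentiable ℂ k ∧ ∀ P, e P = k P.coords

theorem nice_of_mem {e : PartialEquiv (AffineCurve f) ℂ} (he : e ∈ charts f) : Nice e := by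
  rcases he with ⟨b, hb, rfl⟩ | ⟨O, hinj, hO, hd, rfl⟩
  · have hc : Differentiable ℂ (fun t => f.eval t / b ^ 2) := f.differentiable.div_const _
    refine ⟨Complex.isOpen_slitPlane.preimage hc.continuous, ?_,
      ⟨{P | 0 < (P.2 / b).re}, ?_, rfl⟩, Prod.fst, differentiable_fst, fun _ => rfl⟩
    · refine DifferentiableOn.prodMk differentiableOn_id ?_
      refine DifferentiableOn.const_mul ?_ _
      intro t ht
      exact (hc t).differentiableWithinAt.cpow_const ht
    · exact isOpen_lt continuous_const
        (Complex.continuous_re.comp (continuous_snd.div_const b))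
  · have hopen : IsOpen ((fun s => f.eval s) '' O) := by
      rw [isOpen_iff_mem_nhds]
      rintro _ ⟨a, ha, rfl⟩
      have := (f.hasStrictDerivAt a).map_nhds_eq (hd a ha)
      rw [← this]
      exact image_mem_map (hO.mem_nhds ha)
    refine ⟨hopen.preimage (continuous_pow 2), ?_, ⟨{P | P.1 ∈ O},
      hO.preimage continuous_fst, rfl⟩, Prod.snd, differentiable_snd, fun _ => rfl⟩
    have h1 : DifferentiableOn ℂ (Function.invFunOn (fun s => f.eval s) O)
        ((fun s => f.eval s) '' O) := by
      rintro _ ⟨a, ha, rfl⟩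
      refine ((f.hasStrictDerivAt a).to_local_left_inverse (hd a ha)
        (g := Function.invFunOn (fun s => f.eval s) O) ?_).hasDerivAt.differentiableAt.differentiableWithinAt
      filter_upwards [hO.mem_nhds ha] with s hs
      exact hinj.leftInvOn_invFunOn hs
    have h2 : DifferentiableOn ℂ
        (fun t : ℂ => (Function.invFunOn (fun s => f.eval s) O (t ^ 2), t))
        {t | ∃ s ∈ O, f.eval s = t ^ 2} :=
      DifferentiableOn.prodMk (h1.comp (differentiable_pow 2).differentiableOn fun t ht => ht)
        differentiableOn_id
    refine h2.congr fun t ht => ?_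
    have ht' : ∃ s ∈ O, f.eval s = t ^ 2 := ht
    simp only [yChart, PartialEquiv.coe_symm_mk, coords, dif_pos ht']

/-- Transport of a chart along an injection. -/
def push {S : Type} (ι : AffineCurve f → S) (hι : ι.Injective)
    (e : PartialEquiv (AffineCurve f) ℂ) : PartialEquiv S ℂ where
  toFun s := e (Function.invFun ι s)
  invFun z := ι (e.symm z)
  source := ι '' e.source
  target := e.target
  map_source' := by
    rintro _ ⟨P, hP, rfl⟩
    rw [Function.leftInverse_invFun hι]
    exact e.map_source hP
  map_target' := fun z hz => ⟨_, e.map_target hz, rfl⟩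
  left_inv' := by
    rintro _ ⟨P, hP, rfl⟩
    rw [Function.leftInverse_invFun hι, e.left_inv hP]
  right_inv' := by
    intro z hz
    rw [Function.leftInverse_invFun hι, e.right_inv hz]

theorem push_transition {f' : ℂ[X]} {S : Type} {ι : AffineCurve f → S} {ι' : AffineCurve f' → S}
    (hι : ι.Injective) (hι' : ι'.Injective) {e : PartialEquiv (AffineCurve f) ℂ}
    {e' : PartialEquiv (AffineCurve f') ℂ} (he : Nice e) (he' : Nice e')
    (V : Set (ℂ × ℂ)) (τ : ℂ × ℂ → ℂ × ℂ) (hV : IsOpen V) (hτ : DifferentiableOn ℂ τ V)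
    (h1 : ∀ P Q, ι P = ι' Q → P.coords ∈ V ∧ Q.coords = τ P.coords)
    (h2 : ∀ P : AffineCurve f, P.coords ∈ V → ∃ Q, ι P = ι' Q) :
    IsOpen ((push ι hι e).symm.trans (push ι' hι' e')).source ∧
      DifferentiableOn ℂ ((push ι hι e).symm.trans (push ι' hι' e'))
        ((push ι hι e).symm.trans (push ι' hι' e')).source := by
  obtain ⟨O, hO, hsrc⟩ := he'.src
  obtain ⟨k, hk, hfwd⟩ := he'.fwd
  have hsource : ((push ι hι e).symm.trans (push ι' hι' e')).source =
      e.target ∩ (fun z => (e.symm z).coords) ⁻¹' (V ∩ τ ⁻¹' O) := by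
    ext z
    simp only [PartialEquiv.trans_source, PartialEquiv.symm_source, Set.mem_inter_iff,
      Set.mem_preimage]
    refine and_congr Iff.rfl ?_
    change ι (e.symm z) ∈ ι' '' e'.source ↔ _
    rw [hsrc]
    constructor
    · rintro ⟨Q, hQ, hQ2⟩
      obtain ⟨hv, hq⟩ := h1 _ _ hQ2.symm
      exact ⟨hv, hq ▸ hQ⟩
    · rintro ⟨hv, hq⟩
      obtain ⟨Q, hQ⟩ := h2 _ hv
      refine ⟨Q, ?_, hQ.symm⟩
      change Q.coords ∈ O
      rw [(h1 _ _ hQ).2]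
      exact hq
  have hopenV : IsOpen (V ∩ τ ⁻¹' O) := hτ.continuousOn.isOpen_inter_preimage hV hO
  rw [hsource]
  refine ⟨he.diff.continuousOn.isOpen_inter_preimage he.open_target hopenV, ?_⟩
  have hd : DifferentiableOn ℂ (fun z => k (τ (e.symm z).coords))
      (e.target ∩ (fun z => (e.symm z).coords) ⁻¹' (V ∩ τ ⁻¹' O)) :=
    hk.comp_differentiableOn (hτ.comp (he.diff.mono Set.inter_subset_left) fun z hz => hz.2.1)
  refine hd.congr fun z hz => ?_
  obtain ⟨Q, hQ⟩ := h2 _ hz.2.1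
  change e' (Function.invFun ι' (ι (e.symm z))) = _
  rw [hQ, Function.leftInverse_invFun hι', hfwd, (h1 _ _ hQ).2]

end AffineCurve

/-! ### The compact Riemann surface -/

/-- The equation `y ^ 2 = p x` of a regular hyperelliptic surface of genus `g ≥ 1`: the polynomial
`p` has degree `2 g + 1` or `2 g + 2` and no multiple zeros. -/
structure HyperellipticEquation where
  /-- The polynomial. -/
  p : ℂ[X]
  /-- The genus. -/
  g : ℕ
  one_le_g : 1 ≤ g
  natDegree_p : p.natDegree = 2 * g + 1 ∨ p.natDegree = 2 * g + 2
  separable : p.Separable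

namespace HyperellipticEquation

variable (H : HyperellipticEquation)

/-- The polynomial `q u = u ^ (2 g + 2) p (1 / u)`. In the coordinates `u = 1 / x` and
`w = y / x ^ (g + 1)` the equation of the surface is `w ^ 2 = q u`. -/
def q : ℂ[X] := H.p.reflect (2 * H.g + 2)

theorem natDegree_le : H.p.natDegree ≤ 2 * H.g + 2 := by
  rcases H.natDegree_p with h | h <;> omega

theorem eval_q {u : ℂ} (hu : u ≠ 0) : H.q.eval u = u ^ (2 * H.g + 2) * H.p.eval u⁻¹ := by
  let : Invertible u⁻¹ := invertibleOfNonzero (inv_ne_zero hu)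
  have h := eval₂_reflect_mul_pow (RingHom.id ℂ) u⁻¹ (2 * H.g + 2) H.p H.natDegree_le
  simp only [invOf_eq_inv, inv_inv] at h
  change H.q.eval u * _ = H.p.eval u⁻¹ at h
  rw [← h, inv_pow]
  field_simp

theorem eval_p {t : ℂ} (ht : t ≠ 0) : H.p.eval t = t ^ (2 * H.g + 2) * H.q.eval t⁻¹ := by
  rw [H.eval_q (inv_ne_zero ht), inv_inv, inv_pow]
  field_simp

theorem eval_q_zero : H.q.eval 0 = H.p.coeff (2 * H.g + 2) := by
  rw [← coeff_zero_eq_eval_zero, q, coeff_reflect, revAt_le (Nat.zero_le _)]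
  simp

theorem p_regular (a : ℂ) (ha : H.p.eval a = 0) : H.p.derivative.eval a ≠ 0 :=
  H.separable.eval₂_derivative_ne_zero (RingHom.id ℂ) ha

theorem q_regular (a : ℂ) (ha : H.q.eval a = 0) : H.q.derivative.eval a ≠ 0 := by
  by_cases h : a = 0
  · subst h
    rw [eval_q_zero] at ha
    have hdeg : H.p.natDegree = 2 * H.g + 1 := by
      rcases H.natDegree_p with h | h
      · exact h
      · rw [← h, coeff_natDegree, leadingCoeff_eq_zero] at ha
        simp [ha] at h
    rw [← coeff_zero_eq_eval_zero, coeff_derivative, q, coeff_reflect, revAt_le (by omega)]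
    have : 2 * H.g + 2 - (0 + 1) = H.p.natDegree := by omega
    rw [this, coeff_natDegree]
    have h0 : H.p ≠ 0 := by
      rintro h
      simp [h] at hdeg
    simpa using h0
  · have hp : H.p.eval a⁻¹ = 0 := by
      rw [H.eval_q h] at ha
      exact (mul_eq_zero.1 ha).resolve_left (pow_ne_zero _ h)
    have h1 : HasDerivAt (fun u => H.q.eval u) (H.q.derivative.eval a) a := H.q.hasDerivAt a
    have h2 : HasDerivAt (fun u => u ^ (2 * H.g + 2) * H.p.eval u⁻¹)
        (((2 * H.g + 2 : ℕ) : ℂ) * a ^ (2 * H.g + 2 - 1) * H.p.eval a⁻¹ +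
          a ^ (2 * H.g + 2) * (H.p.derivative.eval a⁻¹ * (-(a ^ 2)⁻¹))) a :=
      (hasDerivAt_pow _ a).mul ((H.p.hasDerivAt a⁻¹).comp a (hasDerivAt_inv h))
    have h3 := h1.unique (h2.congr_of_eventuallyEq (by
      filter_upwards [isOpen_ne.mem_nhds h] with u hu using H.eval_q hu))
    rw [h3, hp]
    have := H.p_regular _ hp
    simp [h, this]

/-- The smooth completion of the affine curve `y ^ 2 = p x`. Its points at infinity correspond to
the points with `u = 0` of the curve `w ^ 2 = q u`, where `u = 1 / x` and `w = y / x ^ (g + 1)`: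
there are two of them if the degree of `p` is even, and one if it is odd. -/
inductive Surface : Type
  /-- The points of the affine curve. -/
  | finite (P : AffineCurve H.p) : Surface
  /-- The points at infinity. -/
  | infinite (w : ℂ) (hw : w ^ 2 = H.p.coeff (2 * H.g + 2)) : Surface

namespace Surface

variable {H}

/-- The gluing map `(u, w) ↦ (x, y) = (1 / u, w / u ^ (g + 1))`, extended to `u = 0`. -/
def ofInfinity (H : HyperellipticEquation) (Q : AffineCurve H.q) : H.Surface :=
  open Classical in
  if hu : Q.x = 0 then
    .infinite Q.y (by rw [Q.y_sq, hu, H.eval_q_zero])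
  else
    .finite ⟨Q.x⁻¹, Q.y / Q.x ^ (H.g + 1), by
      rw [div_pow, Q.y_sq, H.eval_q hu]
      field_simp
      ring_nf⟩

theorem finite_injective : (finite : AffineCurve H.p → H.Surface).Injective := by
  intro P Q h
  injection h

theorem ofInfinity_zero {Q : AffineCurve H.q} (h : Q.x = 0) :
    ofInfinity H Q = .infinite Q.y (by rw [Q.y_sq, h, H.eval_q_zero]) := dif_pos h

/-- The change of coordinates `(x, y) ↦ (1 / x, y / x ^ (g + 1))`. -/
def glue (H : HyperellipticEquation) (z : ℂ × ℂ) : ℂ × ℂ := (z.1⁻¹, z.2 / z.1 ^ (H.g + 1))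

theorem differentiableOn_glue : DifferentiableOn ℂ (glue H) {z | z.1 ≠ 0} := by
  intro z hz
  have hz' : z.1 ≠ 0 := hz
  have h1 : DifferentiableAt ℂ (fun z : ℂ × ℂ => z.1) z := differentiableAt_fst
  have h2 : DifferentiableAt ℂ (fun z : ℂ × ℂ => z.2) z := differentiableAt_snd
  have h3 : DifferentiableAt ℂ (fun z : ℂ × ℂ => z.1 ^ (H.g + 1)) z := h1.pow _
  have h4 := (h1.inv hz').prodMk (h2.mul (h3.inv (pow_ne_zero _ hz')))
  exact h4.differentiableWithinAt

theorem isOpen_ne_zero : IsOpen {z : ℂ × ℂ | z.1 ≠ 0} :=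
  isOpen_ne_fun continuous_fst continuous_const

theorem glue_glue {z : ℂ × ℂ} (hz : z.1 ≠ 0) : glue H (glue H z) = z := by
  obtain ⟨a, b⟩ := z
  have ha : a ≠ 0 := hz
  simp only [glue, inv_inv, inv_pow, Prod.mk.injEq, true_and]
  field_simp

theorem ofInfinity_eq_finite {Q : AffineCurve H.q} {P : AffineCurve H.p}
    (h : ofInfinity H Q = finite P) : Q.x ≠ 0 ∧ P.coords = glue H Q.coords := by
  by_cases hu : Q.x = 0
  · rw [ofInfinity_zero hu] at h
    cases h
  · refine ⟨hu, ?_⟩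
    rw [ofInfinity, dif_neg hu] at h
    injection h with h
    rw [← h]
    rfl

theorem finite_eq_ofInfinity {P : AffineCurve H.p} {Q : AffineCurve H.q}
    (h : finite P = ofInfinity H Q) : P.x ≠ 0 ∧ Q.coords = glue H P.coords := by
  obtain ⟨h1, h2⟩ := ofInfinity_eq_finite h.symm
  refine ⟨?_, ?_⟩
  · have : P.x = Q.x⁻¹ := congrArg Prod.fst h2
    rw [this]
    exact inv_ne_zero h1
  · rw [h2, glue_glue h1]

theorem exists_finite (Q : AffineCurve H.q) (h : Q.x ≠ 0) :
    ∃ P : AffineCurve H.p, ofInfinity H Q = finite P :=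
  ⟨_, dif_neg h⟩

theorem exists_ofInfinity (P : AffineCurve H.p) (h : P.x ≠ 0) :
    ∃ Q : AffineCurve H.q, finite P = ofInfinity H Q := by
  have hQ : (P.y / P.x ^ (H.g + 1)) ^ 2 = H.q.eval P.x⁻¹ := by
    rw [div_pow, P.y_sq, H.eval_p h]
    field_simp
    ring_nf
  refine ⟨⟨P.x⁻¹, P.y / P.x ^ (H.g + 1), hQ⟩, ?_⟩
  obtain ⟨P', hP'⟩ := exists_finite ⟨P.x⁻¹, P.y / P.x ^ (H.g + 1), hQ⟩ (inv_ne_zero h)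
  rw [hP']
  congr 1
  apply AffineCurve.ext_coords
  rw [(ofInfinity_eq_finite hP').2]
  exact (glue_glue (z := P.coords) h).symm

theorem ofInfinity_injective : (ofInfinity H).Injective := by
  intro Q Q' h
  by_cases hu : Q.x = 0
  · by_cases hu' : Q'.x = 0
    · rw [ofInfinity_zero hu, ofInfinity_zero hu'] at h
      injection h with h
      exact AffineCurve.ext (hu.trans hu'.symm) h
    · obtain ⟨P, hP⟩ := exists_finite Q' hu'
      exact absurd hu (ofInfinity_eq_finite (h.trans hP)).1
  · obtain ⟨P, hP⟩ := exists_finite Q hu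
    apply AffineCurve.ext_coords
    rw [(finite_eq_ofInfinity hP.symm).2, (finite_eq_ofInfinity (hP.symm.trans h)).2]

/-- The charts of the surface: those of the curve `y ^ 2 = p x` and those of the curve
`w ^ 2 = q u`. -/
def charts (H : HyperellipticEquation) : Set (PartialEquiv H.Surface ℂ) :=
  AffineCurve.push finite finite_injective '' AffineCurve.charts H.p ∪
    AffineCurve.push (ofInfinity H) ofInfinity_injective '' AffineCurve.charts H.q

theorem exists_chart (s : H.Surface) : ∃ e ∈ charts H, s ∈ e.source := by
  cases s with
  | finite P =>
    obtain ⟨e, he, hP⟩ := AffineCurve.exists_chart H.p_regular P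
    exact ⟨_, Or.inl ⟨e, he, rfl⟩, P, hP, rfl⟩
  | infinite w hw =>
    obtain ⟨e, he, hP⟩ := AffineCurve.exists_chart H.q_regular
      ⟨0, w, hw.trans H.eval_q_zero.symm⟩
    exact ⟨_, Or.inr ⟨e, he, rfl⟩, _, hP, ofInfinity_zero rfl⟩

theorem transition {e e' : PartialEquiv H.Surface ℂ} (he : e ∈ charts H) (he' : e' ∈ charts H) :
    IsOpen (e.symm.trans e').source ∧
      DifferentiableOn ℂ (e.symm.trans e') (e.symm.trans e').source := by
  rcases he with ⟨e, he, rfl⟩ | ⟨e, he, rfl⟩ <;> rcases he' with ⟨e', he', rfl⟩ | ⟨e', he', rfl⟩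
  · exact AffineCurve.push_transition _ _ (AffineCurve.nice_of_mem he) (AffineCurve.nice_of_mem he')
      Set.univ id isOpen_univ differentiableOn_id
      (fun P Q h => ⟨trivial, by rw [finite_injective h]; rfl⟩) (fun P _ => ⟨P, rfl⟩)
  · exact AffineCurve.push_transition _ _ (AffineCurve.nice_of_mem he) (AffineCurve.nice_of_mem he')
      _ (glue H) isOpen_ne_zero differentiableOn_glue
      (fun P Q h => finite_eq_ofInfinity h) (fun P h => exists_ofInfinity P h)
  · exact AffineCurve.push_transition _ _ (AffineCurve.nice_of_mem he) (AffineCurve.nice_of_mem he')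
      _ (glue H) isOpen_ne_zero differentiableOn_glue
      (fun P Q h => ofInfinity_eq_finite h) (fun P h => exists_finite P h)
  · exact AffineCurve.push_transition _ _ (AffineCurve.nice_of_mem he) (AffineCurve.nice_of_mem he')
      Set.univ id isOpen_univ differentiableOn_id
      (fun P Q h => ⟨trivial, by rw [ofInfinity_injective h]; rfl⟩) (fun P _ => ⟨P, rfl⟩)

/-- The atlas of the surface. -/
def core (H : HyperellipticEquation) : ChartedSpaceCore ℂ H.Surface where
  atlas := charts H
  chartAt s := (exists_chart s).choose
  mem_chart_source s := (exists_chart s).choose_spec.2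
  chart_mem_atlas s := (exists_chart s).choose_spec.1
  open_source _ _ he he' := (transition he he').1
  continuousOn_toFun _ _ he he' := (transition he he').2.continuousOn

instance : TopologicalSpace H.Surface := (core H).toTopologicalSpace

instance : ChartedSpace ℂ H.Surface := (core H).toChartedSpace

instance : IsManifold 𝓘(ℂ) ω H.Surface := by
  refine isManifold_of_contDiffOn _ _ _ fun e e' he he' => ?_
  have key : ∀ e : OpenPartialHomeomorph H.Surface ℂ, e ∈ atlas ℂ H.Surface →
      e.toPartialEquiv ∈ charts H := by
    intro e he
    obtain ⟨e₀, he₀, h⟩ := Set.mem_iUnion₂.1 he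
    rw [Set.mem_singleton_iff.1 h]
    exact he₀
  obtain ⟨ho, hd⟩ := transition (key e he) (key e' he')
  have h := hd.contDiffOn (n := ω) ho
  simp only [modelWithCornersSelf_coe, modelWithCornersSelf_coe_symm, Set.range_id,
    Set.inter_univ, Set.preimage_id, Function.comp_id, Function.id_comp]
  exact h

/-- The coordinate `x` as a chart of the surface, on the sheet where `y / b` lies in the right half
plane. -/
def xChart (H : HyperellipticEquation) (b : ℂ) (hb : b ≠ 0) : OpenPartialHomeomorph H.Surface ℂ :=
  (core H).openPartialHomeomorph
    (AffineCurve.push finite finite_injective (AffineCurve.xChart H.p b hb))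
    (Or.inl ⟨_, Or.inl ⟨b, hb, rfl⟩, rfl⟩)

theorem xChart_mem_atlas (b : ℂ) (hb : b ≠ 0) : xChart H b hb ∈ atlas ℂ H.Surface :=
  Set.mem_iUnion₂.2 ⟨_, Or.inl ⟨_, Or.inl ⟨b, hb, rfl⟩, rfl⟩, rfl⟩

theorem xChart_mem_maximalAtlas (b : ℂ) (hb : b ≠ 0) :
    xChart H b hb ∈ IsManifold.maximalAtlas 𝓘(ℂ) ω H.Surface :=
  IsManifold.subset_maximalAtlas (xChart_mem_atlas b hb)

theorem finite_mem_xChart_source (b : ℂ) (hb : b ≠ 0) (P : AffineCurve H.p) :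
    finite P ∈ (xChart H b hb).source ↔ 0 < (P.y / b).re := by
  change finite P ∈ finite '' {P : AffineCurve H.p | 0 < (P.y / b).re} ↔ _
  rw [finite_injective.mem_set_image]
  rfl

theorem xChart_finite (b : ℂ) (hb : b ≠ 0) (P : AffineCurve H.p) :
    xChart H b hb (finite P) = P.x := by
  change (Function.invFun finite (finite P) : AffineCurve H.p).x = P.x
  rw [Function.leftInverse_invFun finite_injective]

end Surface

/-- The part of the affine curve where `x` is a local coordinate (where `y ≠ 0`). -/
def XDomain : Type := {P : AffineCurve H.p // P.y ≠ 0}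

namespace XDomain

variable {H}

/-- The coordinate `x`. -/
def x (P : H.XDomain) : ℂ := P.1.x

/-- The coordinate `y`. -/
def y (P : H.XDomain) : ℂ := P.1.y

end XDomain

/-- The filter `x → ∞` on the surface (on all sheets). -/
def xToInfinity : Filter H.XDomain := comap XDomain.x (cocompact ℂ)

end HyperellipticEquation

/-! ### The Virasoro one-point function -/

/-- The Schwarzian derivative `f''' / f' - 3 (f'') ^ 2 / (2 (f') ^ 2)`. -/
def schwarzian (f : ℂ → ℂ) (z : ℂ) : ℂ :=
  iteratedDeriv 3 f z / deriv f z - 3 * iteratedDeriv 2 f z ^ 2 / (2 * deriv f z ^ 2)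

/-- A one-point function `⟨T⟩` of the Virasoro field of central charge `c` on a Riemann surface `M`,
for a state whose zero-point function `⟨1⟩` has the value `Z`: a holomorphic function `⟨T(z)⟩` for
every local coordinate `z` (every chart of the maximal holomorphic atlas), with the transformation
rule `⟨T'(z')⟩ (dz'/dz) ^ 2 = ⟨T(z)⟩ - (c / 12) S(z') ⟨1⟩` under every change of coordinate
`z ↦ z'`. The values of `T φ` outside the range of the coordinate `φ` are irrelevant. -/
structure VirasoroOnePoint (M : Type) [TopologicalSpace M] [ChartedSpace ℂ M] (c Z : ℂ) where
  /-- The function in a given local coordinate. -/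
  T : OpenPartialHomeomorph M ℂ → ℂ → ℂ
  holomorphic : ∀ φ ∈ IsManifold.maximalAtlas 𝓘(ℂ) ω M, DifferentiableOn ℂ (T φ) φ.target
  transform : ∀ φ ∈ IsManifold.maximalAtlas 𝓘(ℂ) ω M, ∀ ψ ∈ IsManifold.maximalAtlas 𝓘(ℂ) ω M,
    ∀ s ∈ φ.source ∩ ψ.source,
      T ψ (ψ s) * deriv (ψ ∘ φ.symm) (φ s) ^ 2 =
        T φ (φ s) - c / 12 * schwarzian (ψ ∘ φ.symm) (φ s) * Z

namespace VirasoroOnePoint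

variable {H : HyperellipticEquation} {c Z : ℂ}

/-- The one-point function `⟨T(x)⟩` in the coordinate `x`, as a function on the part of the
hyperelliptic surface where `x` is a local coordinate. -/
def atX (T : VirasoroOnePoint H.Surface c Z) (P : H.XDomain) : ℂ :=
  T.T (HyperellipticEquation.Surface.xChart H P.y P.2) P.x

/-- The identity `p ⟨T(x)⟩ = (c / 32) (p') ^ 2 / p ⟨1⟩ + (1 / 4) (A(x) + y B(x))`, where `A` and `B`
are the Galois-even part and the Galois-odd part of the polynomial `P(x, y)`. -/
def HasGaloisSplitting (T : VirasoroOnePoint H.Surface c Z) (A B : ℂ[X]) : Prop :=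
  ∀ P : H.XDomain, H.p.eval P.x * T.atX P =
    c / 32 * (H.p.derivative.eval P.x ^ 2 / H.p.eval P.x) * Z +
      1 / 4 * (A.eval P.x + P.y * B.eval P.x)

end VirasoroOnePoint

end

noncomputable section

/-! ### The Schwarzian derivative -/

/-! Off the branch points `x` is a local coordinate, so a one-point function is determined by
`⟨T(x)⟩`. The question is which functions extend holomorphically over the branch points and over
infinity.

On a curve `y ^ 2 = f x` the coordinate at a branch point is `y`, and the squaring map has
Schwarzian `-3 / (2 y ^ 2)`. Passing from `x` to `y` therefore forces `f ⟨T(x)⟩` to have the polar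
part `(c ⟨1⟩ / 32) f' ^ 2 / f`, and four times the remainder (`residue`) stays bounded
(`exists_tendsto_residue`). Conversely, a function whose remainder is `A(x) + y B(x)` with
polynomials `A`, `B` extends (`exists_analyticAt_pullback`). Near infinity the same analysis applies
to `w ^ 2 = q u` with `u = 1 / x`. Inversion has zero Schwarzian, so `⟨T(u)⟩ = x ^ 4 ⟨T(x)⟩`, and
the polar parts in the two patches differ by an explicit polynomial, `twist`
(`residue_infinityPatch`).

Splitting the remainder under `y ↦ -y` gives `A(x) + y B(x)`. Both `A` and `B` are entire by removal
of singularities (`exists_entire`). The bound at infinity and Liouville make them polynomials with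
`deg (x ^ 2 A - twist) ≤ 2 g` and `deg B < g - 2`, with `B = 0` if `g ≤ 2` (`exists_splitting`).
Every such pair occurs (`exists_of_isAdmissible`), by gluing the two patches
(`exists_virasoroOnePoint`).

The rest is read off from this correspondence. The coefficients of `A` in degrees `2 g` and `2 g -
1` are those of `twist`, shifted by two. Below them `2 g - 1` coefficients of `A` are free, and so
are `g - 2` of `B`, which add up to `3 (g - 1)`. The asymptotics of `⟨T(x)⟩` are those of `⟨T(u)⟩`
at `u = 0`, which is a regular point for even degree and a branch point for odd degree. -/

theorem schwarzian_eq (f : ℂ → ℂ) (z : ℂ) : schwarzian f z =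
    deriv (deriv (deriv f)) z / deriv f z - 3 * deriv (deriv f) z ^ 2 / (2 * deriv f z ^ 2) := by
  simp only [schwarzian, iteratedDeriv_succ, iteratedDeriv_zero]

theorem Filter.EventuallyEq.schwarzian_eq {f g : ℂ → ℂ} {z : ℂ} (h : f =ᶠ[𝓝 z] g) :
    schwarzian f z = schwarzian g z := by
  simp only [_root_.schwarzian_eq, h.deriv.deriv.deriv.eq_of_nhds, h.deriv.deriv.eq_of_nhds,
    h.deriv.eq_of_nhds]

theorem analyticAt_schwarzian {f : ℂ → ℂ} {z : ℂ} (hf : AnalyticAt ℂ f z) (h : deriv f z ≠ 0) :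
    AnalyticAt ℂ (schwarzian f) z := by
  rw [funext (schwarzian_eq f)]
  have h1 := hf.deriv
  have h2 := h1.deriv
  exact (h2.deriv.div h1 h).sub
    ((analyticAt_const.mul (h2.pow 2)).div (analyticAt_const.mul (h1.pow 2)) (by simpa using h))

theorem AnalyticAt.eventuallyEq_deriv_comp {f g : ℂ → ℂ} {z : ℂ} (hf : AnalyticAt ℂ f (g z))
    (hg : AnalyticAt ℂ g z) :
    deriv (f ∘ g) =ᶠ[𝓝 z] fun w => deriv f (g w) * deriv g w := by
  filter_upwards [hg.eventually_analyticAt, hg.continuousAt.eventually hf.eventually_analyticAt]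
    with w h1 h2
  exact deriv_comp w h2.differentiableAt h1.differentiableAt

/-- The chain rule for the Schwarzian derivative. -/
theorem schwarzian_comp {f g : ℂ → ℂ} {z : ℂ} (hf : AnalyticAt ℂ f (g z)) (hg : AnalyticAt ℂ g z)
    (hf' : deriv f (g z) ≠ 0) (hg' : deriv g z ≠ 0) :
    schwarzian (f ∘ g) z = schwarzian f (g z) * deriv g z ^ 2 + schwarzian g z := by
  have e1 := hf.eventuallyEq_deriv_comp hg
  have e2 : deriv (deriv (f ∘ g)) =ᶠ[𝓝 z]
      fun w => deriv (deriv f) (g w) * deriv g w ^ 2 + deriv f (g w) * deriv (deriv g) w := by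
    refine e1.deriv.trans ?_
    filter_upwards [hg.eventually_analyticAt, hg.continuousAt.eventually hf.eventually_analyticAt]
      with w h1 h2
    have h3 : HasDerivAt (fun w => deriv f (g w)) (deriv (deriv f) (g w) * deriv g w) w :=
      h2.deriv.differentiableAt.hasDerivAt.comp w h1.differentiableAt.hasDerivAt
    refine (h3.mul h1.deriv.differentiableAt.hasDerivAt).deriv.trans ?_
    ring
  have e3 : deriv (deriv (deriv (f ∘ g))) z =
      deriv (deriv (deriv f)) (g z) * deriv g z ^ 3 +
        3 * deriv (deriv f) (g z) * deriv g z * deriv (deriv g) z +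
        deriv f (g z) * deriv (deriv (deriv g)) z := by
    rw [e2.deriv_eq]
    have h2 : HasDerivAt (fun w => deriv f (g w)) (deriv (deriv f) (g z) * deriv g z) z :=
      hf.deriv.differentiableAt.hasDerivAt.comp z hg.differentiableAt.hasDerivAt
    have h3 : HasDerivAt (fun w => deriv (deriv f) (g w))
        (deriv (deriv (deriv f)) (g z) * deriv g z) z :=
      hf.deriv.deriv.differentiableAt.hasDerivAt.comp z hg.differentiableAt.hasDerivAt
    have h4 := hg.deriv.differentiableAt.hasDerivAt
    have h5 := hg.deriv.deriv.differentiableAt.hasDerivAt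
    have h6 := (h3.mul (h4.pow 2)).add (h2.mul h5)
    refine h6.deriv.trans ?_
    simp only [Pi.pow_apply]
    push_cast
    ring
  rw [schwarzian_eq (f ∘ g), e3, e1.eq_of_nhds, e2.eq_of_nhds, schwarzian_eq, schwarzian_eq]
  field_simp
  ring

theorem schwarzian_id (z : ℂ) : schwarzian id z = 0 := by
  rw [schwarzian_eq]
  simp

/-- Inversion is a Möbius map. This is why `x` and `u = 1 / x` are related without an anomalous
term. -/
theorem schwarzian_inv {z : ℂ} (hz : z ≠ 0) : schwarzian (fun w => w⁻¹) z = 0 := by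
  have e1 : deriv (fun w : ℂ => w⁻¹) = fun w => -(w ^ 2)⁻¹ := deriv_inv'
  have h (n : ℕ) (c : ℂ) {w : ℂ} (hw : w ≠ 0) :
      deriv (fun w : ℂ => c * (w ^ n)⁻¹) w = -(c * n) * (w ^ (n + 1))⁻¹ := by
    rcases n with _ | n
    · simp
    · refine ((((hasDerivAt_pow (n + 1) w).inv (pow_ne_zero _ hw)).const_mul c).deriv).trans ?_
      simp only [Nat.add_sub_cancel]
      field_simp
      ring
  have hne : ∀ᶠ w : ℂ in 𝓝 z, w ≠ 0 := isOpen_ne.mem_nhds hz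
  have e2 : deriv (deriv (fun w : ℂ => w⁻¹)) =ᶠ[𝓝 z] fun w => 2 * (w ^ 3)⁻¹ := by
    filter_upwards [hne] with w hw
    rw [e1]
    simpa using h 2 (-1) hw
  have e3 : deriv (deriv (deriv (fun w : ℂ => w⁻¹))) z = -6 * (z ^ 4)⁻¹ := by
    rw [e2.deriv_eq, h 3 2 hz]
    norm_num
  rw [schwarzian_eq, e3, e2.eq_of_nhds, e1]
  field_simp
  norm_num

/-- The source of the constant `c / 32`: `c / 12` times `3 / (2 y ^ 2)` times `(dy / dx) ^ 2 = f' ^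
2 / (4 f)`. -/
theorem schwarzian_sq {z : ℂ} (hz : z ≠ 0) :
    schwarzian (fun w => w ^ 2) z = -3 / (2 * z ^ 2) := by
  have e1 : deriv (fun w : ℂ => w ^ 2) = fun w => 2 * w := by
    funext w
    simp
  have e2 : deriv (deriv (fun w : ℂ => w ^ 2)) = fun _ => 2 := by
    rw [e1]
    funext w
    simp
  rw [schwarzian_eq, e2, e1]
  simp
  field_simp

/-! ### Removal of singularities -/

/-- The function whose values are the limits of `F` along punctured neighbourhoods. -/
def limExtend (F : ℂ → ℂ) (z : ℂ) : ℂ := limUnder (𝓝[≠] z) F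

/-- Equality near `a` off `a` is also equality on punctured neighbourhoods of every point near `a`,
so all the punctured limits there are values of `g`, including the one at `a`. -/
theorem limExtend_eventuallyEq {F g : ℂ → ℂ} {a : ℂ} (hg : AnalyticAt ℂ g a)
    (h : F =ᶠ[𝓝[≠] a] g) : limExtend F =ᶠ[𝓝 a] g := by
  have h2 : ∀ᶠ z in 𝓝 a, F =ᶠ[𝓝[≠] z] g := by
    filter_upwards [eventually_eventually_nhds.2 (eventually_nhdsWithin_iff.1 h)] with z hz
    by_cases hza : z = a
    · rwa [hza]
    · refine Eventually.filter_mono nhdsWithin_le_nhds ?_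
      filter_upwards [hz, isOpen_ne.mem_nhds hza] with w hw hwa using hw hwa
  filter_upwards [h2, hg.eventually_analyticAt] with z hz hgz
  exact ((hgz.continuousAt.tendsto.mono_left nhdsWithin_le_nhds).congr' hz.symm).limUnder_eq

theorem limExtend_eq {F : ℂ → ℂ} {a : ℂ} (hF : ContinuousAt F a) : limExtend F a = F a :=
  (hF.tendsto.mono_left nhdsWithin_le_nhds).limUnder_eq

/-- A function that is holomorphic near an isolated singularity and grows more slowly than a simple
pole agrees with an analytic function. -/
theorem exists_analyticAt_of_isLittleO {F : ℂ → ℂ} {a : ℂ}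
    (hd : ∀ᶠ z in 𝓝[≠] a, DifferentiableAt ℂ F z)
    (ho : Tendsto (fun z => (z - a) * F z) (𝓝[≠] a) (𝓝 0)) :
    ∃ g, AnalyticAt ℂ g a ∧ F =ᶠ[𝓝[≠] a] g := by
  obtain ⟨U, hU, hUo, hUa⟩ := eventually_nhds_iff.1 (eventually_nhdsWithin_iff.1 hd)
  have ho' : (fun z => F z - F a) =o[𝓝[≠] a] fun z => (z - a)⁻¹ := by
    refine (isLittleO_iff_tendsto' ?_).2 ?_
    · filter_upwards [eventually_mem_nhdsWithin] with z hz h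
      exact absurd (sub_eq_zero.1 (inv_eq_zero.1 h)) hz
    · have h2 : Tendsto (fun z => (z - a) * F z - (z - a) * F a) (𝓝[≠] a) (𝓝 (0 - 0 * F a)) := by
        refine ho.sub (Tendsto.mul_const _ ?_)
        have : Tendsto (fun z => z - a) (𝓝 a) (𝓝 (a - a)) :=
          (continuous_id.sub continuous_const).tendsto a
        rw [sub_self] at this
        exact this.mono_left nhdsWithin_le_nhds
      simp only [zero_mul, sub_zero] at h2
      refine h2.congr fun z => ?_
      rw [div_inv_eq_mul]
      ring
  have h := Complex.differentiableOn_update_limUnder_of_isLittleO (hUo.mem_nhds hUa)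
    (fun z hz => (hU z hz.1 hz.2).differentiableWithinAt) ho'
  refine ⟨_, h.analyticAt (hUo.mem_nhds hUa), ?_⟩
  filter_upwards [eventually_mem_nhdsWithin] with z hz
  rw [Function.update_of_ne hz]

/-! ### Entire functions of polynomial growth and asymptotics of polynomials -/

/-- Liouville by induction: the entire difference quotient `(F x - F 0) / x` grows one power more
slowly, and an entire function that tends to zero at infinity vanishes. -/
theorem exists_polynomial_of_isLittleO (m : ℕ) : ∀ {F : ℂ → ℂ}, Differentiable ℂ F →
    F =o[cocompact ℂ] (fun x => x ^ m) → ∃ P ∈ degreeLT ℂ m, ∀ x, F x = P.eval x := by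
  induction m with
  | zero =>
    intro F hF h
    simp only [pow_zero] at h
    refine ⟨0, Submodule.zero_mem _, fun x => ?_⟩
    have h1 : Tendsto F (cocompact ℂ) (𝓝 0) := (isLittleO_one_iff ℂ).1 h
    simpa using hF.apply_eq_of_tendsto_cocompact x h1
  | succ m ih =>
    intro F hF h
    have hd : Differentiable ℂ (dslope F 0) := by
      rw [← differentiableOn_univ]
      exact (Complex.differentiableOn_dslope univ_mem).2 hF.differentiableOn
    have hne : ∀ᶠ x : ℂ in cocompact ℂ, x ≠ 0 :=
      (isCompact_singleton (x := (0 : ℂ))).compl_mem_cocompact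
    have h1 : dslope F 0 =o[cocompact ℂ] fun x => x ^ m := by
      have h2 : (fun x => F x - F 0) =o[cocompact ℂ] fun x => x ^ (m + 1) := by
        refine h.sub ((isLittleO_const_left (c := F 0)).2 (Or.inr ?_))
        simp only [Function.comp_def, norm_pow]
        exact (tendsto_pow_atTop (Nat.succ_ne_zero m)).comp tendsto_norm_cocompact_atTop
      have h3 := h2.mul_isBigO (isBigO_refl (fun x : ℂ => x⁻¹) (cocompact ℂ))
      refine h3.congr' ?_ ?_
      · filter_upwards [hne] with x hx
        rw [dslope_of_ne _ hx, slope_def_field]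
        simp [div_eq_mul_inv]
      · filter_upwards [hne] with x hx
        field_simp
        ring
    obtain ⟨P, hP, hP'⟩ := ih hd h1
    refine ⟨X * P + C (F 0), ?_, fun x => ?_⟩
    · rw [mem_degreeLT] at hP ⊢
      refine (degree_add_le _ _).trans_lt (max_lt ?_ ?_)
      · by_cases h0 : P = 0
        · simp [h0]
        · rw [degree_mul, degree_X, degree_eq_natDegree h0] at *
          have : P.natDegree < m := by exact_mod_cast hP
          exact_mod_cast (by omega : 1 + P.natDegree < m + 1)
      · refine degree_C_le.trans_lt ?_
        exact_mod_cast Nat.succ_pos m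
    · have := sub_smul_dslope F 0 x
      simp only [sub_zero, smul_eq_mul] at this
      simp only [eval_add, eval_mul, eval_X, eval_C, ← hP', this]
      ring

theorem eval_reflect {f : ℂ[X]} {m : ℕ} (h : f.natDegree ≤ m) {u : ℂ} (hu : u ≠ 0) :
    (f.reflect m).eval u = u ^ m * f.eval u⁻¹ := by
  let : Invertible u⁻¹ := invertibleOfNonzero (inv_ne_zero hu)
  have h := eval₂_reflect_mul_pow (RingHom.id ℂ) u⁻¹ m f h
  simp only [invOf_eq_inv, inv_inv] at h
  change (f.reflect m).eval u * _ = f.eval u⁻¹ at h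
  rw [← h, inv_pow]
  field_simp

theorem eventually_ne_zero_cocompact : ∀ᶠ x : ℂ in cocompact ℂ, x ≠ 0 :=
  (isCompact_singleton (x := (0 : ℂ))).compl_mem_cocompact

theorem tendsto_inv_cocompact : Tendsto (fun x : ℂ => x⁻¹) (cocompact ℂ) (𝓝 0) :=
  tendsto_inv₀_cobounded.mono_left (Metric.cobounded_eq_cocompact (α := ℂ)).ge

theorem tendsto_eval_div_pow {f : ℂ[X]} {m : ℕ} (h : f.natDegree ≤ m) :
    Tendsto (fun x => f.eval x / x ^ m) (cocompact ℂ) (𝓝 (f.coeff m)) := by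
  have h1 := ((f.reflect m).continuous.tendsto 0).comp tendsto_inv_cocompact
  rw [← coeff_zero_eq_eval_zero, coeff_reflect, revAt_le (Nat.zero_le _), Nat.sub_zero] at h1
  refine h1.congr' ?_
  filter_upwards [eventually_ne_zero_cocompact] with x hx
  rw [Function.comp_apply, eval_reflect h (inv_ne_zero hx), inv_inv, inv_pow]
  field_simp

theorem isBigO_eval {f : ℂ[X]} {m : ℕ} (h : f.natDegree ≤ m) :
    (fun x => f.eval x) =O[cocompact ℂ] fun x => x ^ m :=
  isBigO_of_div_tendsto_nhds (by
    filter_upwards [eventually_ne_zero_cocompact] with x hx h0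
    exact absurd h0 (pow_ne_zero _ hx)) _ (tendsto_eval_div_pow h)

theorem isBigO_pow_eval {f : ℂ[X]} {m : ℕ} (h : f.natDegree ≤ m) (h' : f.coeff m ≠ 0) :
    (fun x => x ^ m) =O[cocompact ℂ] fun x => f.eval x := by
  have h1 := (tendsto_eval_div_pow h).inv₀ h'
  simp only [inv_div] at h1
  refine isBigO_of_div_tendsto_nhds ?_ _ h1
  filter_upwards [eventually_ne_zero_cocompact, (tendsto_eval_div_pow h).eventually_ne h']
    with x hx h2 h0
  exact absurd (by rw [h0, zero_div]) h2

/-! ### Coordinate changes -/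

theorem analyticAt_transition {M : Type} [TopologicalSpace M] [ChartedSpace ℂ M]
    [IsManifold 𝓘(ℂ) ω M] {φ ψ : OpenPartialHomeomorph M ℂ}
    (hφ : φ ∈ IsManifold.maximalAtlas 𝓘(ℂ) ω M) (hψ : ψ ∈ IsManifold.maximalAtlas 𝓘(ℂ) ω M)
    {s : M} (hs : s ∈ φ.source) (hs' : s ∈ ψ.source) :
    AnalyticAt ℂ (ψ ∘ φ.symm) (φ s) := by
  have h := (contDiffGroupoid ω 𝓘(ℂ)).mem_of_eqOnSource
    (IsManifold.compatible_of_mem_maximalAtlas hφ hψ) (Setoid.refl _)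
  rw [contDiffGroupoid, mem_groupoid_of_pregroupoid] at h
  have h1 := h.1
  simp only [contDiffPregroupoid, modelWithCornersSelf_coe, modelWithCornersSelf_coe_symm,
    Set.range_id, Set.inter_univ, Set.preimage_id, Function.comp_id, Function.id_comp] at h1
  refine (h1.contDiffAt ((φ.symm.trans ψ).open_source.mem_nhds ?_)).analyticAt
  simp [hs, hs']

theorem transition_comp_eventuallyEq {M : Type} [TopologicalSpace M]
    {φ ψ : OpenPartialHomeomorph M ℂ} {s : M} (hs : s ∈ φ.source) (hs' : s ∈ ψ.source)
    {α : Type} (F : M → α) :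
    F ∘ φ.symm =ᶠ[𝓝 (φ s)] (F ∘ ψ.symm) ∘ (ψ ∘ φ.symm) := by
  have h : ∀ᶠ z in 𝓝 (φ s), φ.symm z ∈ ψ.source := by
    have := φ.continuousAt_symm (φ.map_source hs)
    refine this.eventually (ψ.open_source.mem_nhds ?_)
    rwa [φ.left_inv hs]
  filter_upwards [h] with z hz
  simp only [Function.comp_apply]
  rw [ψ.left_inv hz]

/-- The composition with the reverse transition is locally the identity, so by the chain rule the
product of the two derivatives is one. -/
theorem deriv_transition_ne_zero {M : Type} [TopologicalSpace M] [ChartedSpace ℂ M]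
    [IsManifold 𝓘(ℂ) ω M] {φ ψ : OpenPartialHomeomorph M ℂ}
    (hφ : φ ∈ IsManifold.maximalAtlas 𝓘(ℂ) ω M) (hψ : ψ ∈ IsManifold.maximalAtlas 𝓘(ℂ) ω M)
    {s : M} (hs : s ∈ φ.source) (hs' : s ∈ ψ.source) :
    deriv (ψ ∘ φ.symm) (φ s) ≠ 0 := by
  intro h0
  have h1 := transition_comp_eventuallyEq hs hs' φ
  have h2 : φ ∘ φ.symm =ᶠ[𝓝 (φ s)] id := by
    filter_upwards [φ.open_target.mem_nhds (φ.map_source hs)] with z hz using φ.right_inv hz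
  have h3 := (h2.symm.trans h1).deriv_eq
  have h4 : (ψ ∘ φ.symm) (φ s) = ψ s := by simp [φ.left_inv hs]
  have h5 := analyticAt_transition hψ hφ hs' hs
  rw [deriv_comp _ (by rw [h4]; exact h5.differentiableAt)
    (analyticAt_transition hφ hψ hs hs').differentiableAt, h0, mul_zero, deriv_id] at h3
  exact one_ne_zero h3

/-! ### The two affine patches and their coordinate functions -/

namespace HyperellipticEquation

/-- An affine plane curve inside the hyperelliptic surface whose charts belong to the atlas. -/
structure Patch (H : HyperellipticEquation) where
  /-- The polynomial of the plane curve. -/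
  f : ℂ[X]
  /-- The inclusion. -/
  ι : AffineCurve f → H.Surface
  injective : ι.Injective
  regular : ∀ a, f.eval a = 0 → f.derivative.eval a ≠ 0
  push_mem : ∀ e ∈ AffineCurve.charts f, AffineCurve.push ι injective e ∈ Surface.charts H

variable {H : HyperellipticEquation}

/-- The curve `y ^ 2 = p x`. -/
def finitePatch (H : HyperellipticEquation) : Patch H where
  f := H.p
  ι := Surface.finite
  injective := Surface.finite_injective
  regular := H.p_regular
  push_mem e he := Or.inl ⟨e, he, rfl⟩

/-- The curve `w ^ 2 = q u`. -/
def infinityPatch (H : HyperellipticEquation) : Patch H where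
  f := H.q
  ι := Surface.ofInfinity H
  injective := Surface.ofInfinity_injective
  regular := H.q_regular
  push_mem e he := Or.inr ⟨e, he, rfl⟩

namespace Patch

variable (π : Patch H)

/-- A chart of the plane curve as a chart of the surface. -/
def chart (e : PartialEquiv (AffineCurve π.f) ℂ) (he : e ∈ AffineCurve.charts π.f) :
    OpenPartialHomeomorph H.Surface ℂ :=
  (Surface.core H).openPartialHomeomorph (AffineCurve.push π.ι π.injective e) (π.push_mem e he)

variable {π} {e : PartialEquiv (AffineCurve π.f) ℂ} {he : e ∈ AffineCurve.charts π.f}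

theorem chart_mem_maximalAtlas : π.chart e he ∈ IsManifold.maximalAtlas 𝓘(ℂ) ω H.Surface :=
  IsManifold.subset_maximalAtlas (Set.mem_iUnion₂.2 ⟨_, π.push_mem e he, rfl⟩)

theorem mem_chart_source {P : AffineCurve π.f} : π.ι P ∈ (π.chart e he).source ↔ P ∈ e.source :=
  π.injective.mem_set_image

theorem invFun_ι (P : AffineCurve π.f) : Function.invFun π.ι (π.ι P) = P :=
  Function.leftInverse_invFun π.injective P

theorem chart_apply (P : AffineCurve π.f) : π.chart e he (π.ι P) = e P := by
  change e (Function.invFun π.ι (π.ι P)) = _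
  rw [invFun_ι]

theorem chart_symm_apply (z : ℂ) : (π.chart e he).symm z = π.ι (e.symm z) := rfl

variable (π) in
/-- The coordinate `x` of the plane curve. -/
def X (s : H.Surface) : ℂ := (Function.invFun π.ι s).x

variable (π) in
/-- The coordinate `y` of the plane curve. -/
def Y (s : H.Surface) : ℂ := (Function.invFun π.ι s).y

@[simp] theorem X_ι (P : AffineCurve π.f) : π.X (π.ι P) = P.x := by rw [X, invFun_ι]

@[simp] theorem Y_ι (P : AffineCurve π.f) : π.Y (π.ι P) = P.y := by rw [Y, invFun_ι]

theorem isOpen_range : IsOpen (Set.range π.ι) := by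
  rw [isOpen_iff_mem_nhds]
  rintro _ ⟨P, rfl⟩
  obtain ⟨e, he, hP⟩ := AffineCurve.exists_chart π.regular P
  refine mem_of_superset ((π.chart e he).open_source.mem_nhds (mem_chart_source.2 hP)) ?_
  rintro _ ⟨Q, -, rfl⟩
  exact ⟨Q, rfl⟩

/-- The plane curve carries no topology of its own; `comap coords (𝓝 P.coords)` serves as the
neighbourhood filter of `P` induced from the plane. Together with `tendsto_coords` this identifies
it with the topology of the surface near `π.ι P`. -/
theorem tendsto_ι (P : AffineCurve π.f) :
    Tendsto π.ι (comap AffineCurve.coords (𝓝 P.coords)) (𝓝 (π.ι P)) := by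
  obtain ⟨e, he, hP⟩ := AffineCurve.exists_chart π.regular P
  have hn := AffineCurve.nice_of_mem he
  obtain ⟨O, hO, hsrc⟩ := hn.src
  obtain ⟨k, hk, hfwd⟩ := hn.fwd
  have hs : π.ι P ∈ (π.chart e he).source := mem_chart_source.2 hP
  rw [← (π.chart e he).symm_map_nhds_eq hs, chart_apply]
  have h1 : Tendsto e (comap AffineCurve.coords (𝓝 P.coords)) (𝓝 (e P)) := by
    rw [funext hfwd]
    exact (hk.continuous.tendsto _).comp tendsto_comap
  refine (tendsto_map.comp h1).congr' ?_
  have h2 : ∀ᶠ Q : AffineCurve π.f in comap AffineCurve.coords (𝓝 P.coords), Q.coords ∈ O :=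
    tendsto_comap.eventually (hO.mem_nhds (by rw [hsrc] at hP; exact hP))
  filter_upwards [h2] with Q hQ
  have hQ' : Q ∈ e.source := by rw [hsrc]; exact hQ
  rw [Function.comp_apply, chart_symm_apply, e.left_inv hQ']

theorem tendsto_coords (P : AffineCurve π.f) :
    Tendsto (fun s => (π.X s, π.Y s)) (𝓝 (π.ι P)) (𝓝 P.coords) := by
  obtain ⟨e, he, hP⟩ := AffineCurve.exists_chart π.regular P
  have hn := AffineCurve.nice_of_mem he
  have hs : π.ι P ∈ (π.chart e he).source := mem_chart_source.2 hP
  rw [← (π.chart e he).symm_map_nhds_eq hs, chart_apply, tendsto_map'_iff]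
  have h1 := (hn.diff.differentiableAt (hn.open_target.mem_nhds (e.map_source hP))).continuousAt
  have h2 : ((fun s => (π.X s, π.Y s)) ∘ (π.chart e he).symm) = fun z => (e.symm z).coords := by
    funext z
    simp [chart_symm_apply, AffineCurve.coords]
  rw [h2]
  convert h1.tendsto
  rw [e.left_inv hP]

variable {φ : OpenPartialHomeomorph H.Surface ℂ} {P : AffineCurve π.f}

/-- In a chart of the patch the inverse is holomorphic into the plane; an arbitrary chart differs
from it by an analytic transition. -/
theorem analyticAt_coords (hφ : φ ∈ IsManifold.maximalAtlas 𝓘(ℂ) ω H.Surface)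
    (hP : π.ι P ∈ φ.source) :
    AnalyticAt ℂ (π.X ∘ φ.symm) (φ (π.ι P)) ∧ AnalyticAt ℂ (π.Y ∘ φ.symm) (φ (π.ι P)) := by
  obtain ⟨e, he, heP⟩ := AffineCurve.exists_chart π.regular P
  have hs : π.ι P ∈ (π.chart e he).source := mem_chart_source.2 heP
  have hn := AffineCurve.nice_of_mem he
  have hd : AnalyticAt ℂ (fun z => (e.symm z).coords) (e P) :=
    hn.diff.analyticAt (hn.open_target.mem_nhds (e.map_source heP))
  have hx : AnalyticAt ℂ (π.X ∘ (π.chart e he).symm) (e P) := by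
    refine (analyticAt_fst.comp hd).congr (Eventually.of_forall fun z => ?_)
    simp [chart_symm_apply, AffineCurve.coords]
  have hy : AnalyticAt ℂ (π.Y ∘ (π.chart e he).symm) (e P) := by
    refine (analyticAt_snd.comp hd).congr (Eventually.of_forall fun z => ?_)
    simp [chart_symm_apply, AffineCurve.coords]
  have ht := analyticAt_transition hφ chart_mem_maximalAtlas hP hs
  have h0 : (π.chart e he ∘ φ.symm) (φ (π.ι P)) = e P := by
    rw [Function.comp_apply, φ.left_inv hP, chart_apply]
  constructor
  · exact (hx.comp_of_eq ht h0).congr (transition_comp_eventuallyEq hP hs π.X).symm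
  · exact (hy.comp_of_eq ht h0).congr (transition_comp_eventuallyEq hP hs π.Y).symm

theorem eval_X_eventuallyEq (hP : π.ι P ∈ φ.source) :
    (fun z => π.f.eval z) ∘ (π.X ∘ φ.symm) =ᶠ[𝓝 (φ (π.ι P))]
      (fun z => z ^ 2) ∘ (π.Y ∘ φ.symm) := by
  have h := φ.continuousAt_symm (φ.map_source hP)
  rw [ContinuousAt, φ.left_inv hP] at h
  filter_upwards [h.eventually (isOpen_range.mem_nhds ⟨P, rfl⟩)] with z hz
  obtain ⟨Q, hQ⟩ := hz
  simp only [Function.comp_apply, ← hQ, X_ι, Y_ι]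
  exact Q.y_sq.symm

theorem xChart_mem (f : ℂ[X]) (b : ℂ) (hb : b ≠ 0) :
    AffineCurve.xChart f b hb ∈ AffineCurve.charts f := Or.inl ⟨b, hb, rfl⟩

theorem mem_xChart_source (hy : P.y ≠ 0) :
    π.ι P ∈ (π.chart (AffineCurve.xChart π.f P.y hy) (xChart_mem _ _ _)).source := by
  rw [mem_chart_source]
  change 0 < (P.y / P.y).re
  rw [div_self hy]
  simp

/-- Where `y ≠ 0` the function `X` agrees with a chart, so this is the derivative of a transition.
The same argument with `Y` works at the branch points, where `f' ≠ 0`. -/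
theorem deriv_X_ne_zero (hφ : φ ∈ IsManifold.maximalAtlas 𝓘(ℂ) ω H.Surface)
    (hP : π.ι P ∈ φ.source) (hy : P.y ≠ 0) : deriv (π.X ∘ φ.symm) (φ (π.ι P)) ≠ 0 := by
  have hs := mem_xChart_source hy
  have h1 := deriv_transition_ne_zero hφ chart_mem_maximalAtlas hP hs
  rw [(transition_comp_eventuallyEq hP hs π.X).deriv_eq]
  have h2 : π.X ∘ (π.chart (AffineCurve.xChart π.f P.y hy) (xChart_mem _ _ _)).symm = id := by
    funext z
    simp only [Function.comp_apply, chart_symm_apply, X_ι]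
    rfl
  rwa [h2, Function.id_comp]

theorem deriv_Y_ne_zero (hφ : φ ∈ IsManifold.maximalAtlas 𝓘(ℂ) ω H.Surface)
    (hP : π.ι P ∈ φ.source) (hy : P.y = 0) : deriv (π.Y ∘ φ.symm) (φ (π.ι P)) ≠ 0 := by
  have h0 : π.f.eval P.x = 0 := by rw [← P.y_sq, hy]; simp
  obtain ⟨O, hPO, hO, hinj, hd⟩ := AffineCurve.exists_injOn (π.regular _ h0)
  have he : AffineCurve.yChart π.f O hinj ∈ AffineCurve.charts π.f :=
    Or.inr ⟨O, hinj, hO, hd, rfl⟩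
  have hs : π.ι P ∈ (π.chart _ he).source := mem_chart_source.2 hPO
  have h1 := deriv_transition_ne_zero hφ chart_mem_maximalAtlas hP hs
  have h2 : π.Y ∘ φ.symm =ᶠ[𝓝 (φ (π.ι P))] π.chart _ he ∘ φ.symm := by
    have h := φ.continuousAt_symm (φ.map_source hP)
    rw [ContinuousAt, φ.left_inv hP] at h
    filter_upwards [h.eventually (isOpen_range.mem_nhds ⟨P, rfl⟩)] with z hz
    obtain ⟨Q, hQ⟩ := hz
    simp only [Function.comp_apply, ← hQ, Y_ι, chart_apply]
    rfl
  rwa [h2.deriv_eq]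

end Patch

end HyperellipticEquation

/-! ### Projective connections and their extension over the branch points -/

namespace HyperellipticEquation

variable {H : HyperellipticEquation}

namespace Patch

variable (π : Patch H) {φ : OpenPartialHomeomorph H.Surface ℂ} {P : AffineCurve π.f}

/-- The expression in the coordinate `φ` of a projective connection of central charge `κ` that is
given by `θ` in the coordinate `x` of the plane curve. -/
def pullback (κ : ℂ) (θ : H.Surface → ℂ) (φ : OpenPartialHomeomorph H.Surface ℂ) (z : ℂ) : ℂ :=
  θ (φ.symm z) * deriv (π.X ∘ φ.symm) z ^ 2 + κ / 12 * schwarzian (π.X ∘ φ.symm) z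

/-- Four times the difference of `f θ` and its polar part at the branch points. -/
def residue (κ : ℂ) (θ : H.Surface → ℂ) (P : AffineCurve π.f) : ℂ :=
  4 * (π.f.eval P.x * θ (π.ι P) - κ / 32 * (π.f.derivative.eval P.x ^ 2 / π.f.eval P.x))

variable {π}

theorem eval_ne_zero (hy : P.y ≠ 0) : π.f.eval P.x ≠ 0 := by
  rw [← P.y_sq]
  exact pow_ne_zero _ hy

theorem deriv_eval (f : ℂ[X]) : deriv (fun z => f.eval z) = fun z => f.derivative.eval z :=
  funext fun _ => f.deriv

theorem eventually_eq_ι (hP : π.ι P ∈ φ.source) :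
    ∀ᶠ z in 𝓝 (φ (π.ι P)), z ∈ φ.target ∧ ∃ Q, φ.symm z = π.ι Q := by
  have h := φ.continuousAt_symm (φ.map_source hP)
  rw [ContinuousAt, φ.left_inv hP] at h
  filter_upwards [φ.open_target.mem_nhds (φ.map_source hP),
    h.eventually (isOpen_range.mem_nhds ⟨P, rfl⟩)] with z hz ⟨Q, hQ⟩
  exact ⟨hz, Q, hQ.symm⟩

theorem comp_symm_apply (hP : π.ι P ∈ φ.source) {α : Type} (F : H.Surface → α) :
    (F ∘ φ.symm) (φ (π.ι P)) = F (π.ι P) := by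
  rw [Function.comp_apply, φ.left_inv hP]

/-- The expression of a projective connection in terms of the coordinate `y`. -/
theorem pullback_eq_of_deriv_Y_ne_zero (κ : ℂ) (θ : H.Surface → ℂ)
    (hφ : φ ∈ IsManifold.maximalAtlas 𝓘(ℂ) ω H.Surface) (hP : π.ι P ∈ φ.source) (hy : P.y ≠ 0)
    (hY : deriv (π.Y ∘ φ.symm) (φ (π.ι P)) ≠ 0) (hf : π.f.derivative.eval P.x ≠ 0) :
    π.pullback κ θ φ (φ (π.ι P)) =
      (π.residue κ θ P / π.f.derivative.eval P.x ^ 2 -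
        κ / 3 * schwarzian (fun z => π.f.eval z) P.x * P.y ^ 2 / π.f.derivative.eval P.x ^ 2) *
          deriv (π.Y ∘ φ.symm) (φ (π.ι P)) ^ 2 +
        κ / 12 * schwarzian (π.Y ∘ φ.symm) (φ (π.ι P)) := by
  obtain ⟨hXa, hYa⟩ := analyticAt_coords hφ hP
  have hX := deriv_X_ne_zero hφ hP hy
  have hX0 : (π.X ∘ φ.symm) (φ (π.ι P)) = P.x := by rw [comp_symm_apply hP, X_ι]
  have hY0 : (π.Y ∘ φ.symm) (φ (π.ι P)) = P.y := by rw [comp_symm_apply hP, Y_ι]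
  have hfa : ∀ x, AnalyticAt ℂ (fun z => π.f.eval z) x :=
    fun x => π.f.differentiable.analyticAt x
  have hsa : ∀ x, AnalyticAt ℂ (fun z : ℂ => z ^ 2) x := fun x => (differentiable_pow 2).analyticAt x
  have hs' : ∀ x : ℂ, deriv (fun z : ℂ => z ^ 2) x = 2 * x := fun x => by simp
  have hev := eval_X_eventuallyEq hP
  have h1 := hev.deriv_eq
  rw [deriv_comp _ (hfa _).differentiableAt hXa.differentiableAt,
    deriv_comp _ (hsa _).differentiableAt hYa.differentiableAt, hX0, hY0, hs', deriv_eval] at h1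
  -- The Schwarzians of the two sides of `f(X) = Y ^ 2`, by the chain rule, express `S(X)` through
  -- `S(Y)`. The summand `-3 / (2 y ^ 2)` cancels the polar part that `residue` subtracts.
  have h2 := hev.schwarzian_eq
  rw [schwarzian_comp (hfa _) hXa (by rw [hX0, deriv_eval]; exact hf) hX,
    schwarzian_comp (hsa _) hYa (by rw [hY0, hs']; simpa using hy) hY, hX0, hY0,
    schwarzian_sq hy] at h2
  have h3 : deriv (π.X ∘ φ.symm) (φ (π.ι P)) =
      2 * P.y * deriv (π.Y ∘ φ.symm) (φ (π.ι P)) / π.f.derivative.eval P.x := by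
    field_simp
    linear_combination h1
  rw [pullback, eq_sub_of_add_eq' h2, φ.left_inv hP, h3, residue, ← P.y_sq]
  field_simp
  ring

/-- In this chart `X` is the identity, so the derivative is one and the Schwarzian term drops out.
-/
theorem pullback_xChart (κ : ℂ) (θ : H.Surface → ℂ) {b : ℂ} {hb : b ≠ 0}
    (hP : 0 < (P.y / b).re) :
    π.pullback κ θ (π.chart (AffineCurve.xChart π.f b hb) (xChart_mem _ _ _)) P.x = θ (π.ι P) := by
  have h2 : π.X ∘ (π.chart (AffineCurve.xChart π.f b hb) (xChart_mem _ _ _)).symm = id := by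
    funext z
    simp only [Function.comp_apply, chart_symm_apply, X_ι]
    rfl
  rw [pullback, h2, schwarzian_id, deriv_id, chart_symm_apply]
  have : (AffineCurve.xChart π.f b hb).symm P.x = P :=
    (AffineCurve.xChart π.f b hb).left_inv hP
  rw [this]
  ring

/-- A projective connection with the appropriate poles extends over the branch points. -/
theorem exists_analyticAt_pullback {κ : ℂ} {θ : H.Surface → ℂ} {A B : ℂ[X]}
    (hθ : ∀ Q : AffineCurve π.f, Q.y ≠ 0 → π.residue κ θ Q = A.eval Q.x + Q.y * B.eval Q.x)
    (hφ : φ ∈ IsManifold.maximalAtlas 𝓘(ℂ) ω H.Surface) (hP : π.ι P ∈ φ.source) :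
    ∃ g, AnalyticAt ℂ g (φ (π.ι P)) ∧ π.pullback κ θ φ =ᶠ[𝓝[≠] φ (π.ι P)] g ∧
      (P.y ≠ 0 → ContinuousAt (π.pullback κ θ φ) (φ (π.ι P))) := by
  obtain ⟨hXa, hYa⟩ := analyticAt_coords hφ hP
  have hX0 : (π.X ∘ φ.symm) (φ (π.ι P)) = P.x := by rw [comp_symm_apply hP, X_ι]
  have hY0 : (π.Y ∘ φ.symm) (φ (π.ι P)) = P.y := by rw [comp_symm_apply hP, Y_ι]
  have hev : ∀ f : ℂ[X], AnalyticAt ℂ (fun z => f.eval ((π.X ∘ φ.symm) z)) (φ (π.ι P)) :=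
    fun f => (f.differentiable.analyticAt _).comp hXa
  have hR := (hev A).add (hYa.mul (hev B))
  by_cases hy : P.y = 0
  · have hYd := deriv_Y_ne_zero hφ hP hy
    have hf : π.f.derivative.eval P.x ≠ 0 := π.regular _ (by rw [← P.y_sq, hy]; simp)
    have hf2 : π.f.derivative.eval ((π.X ∘ φ.symm) (φ (π.ι P))) ^ 2 ≠ 0 := by
      rw [hX0]
      exact pow_ne_zero _ hf
    have hSf : AnalyticAt ℂ (schwarzian (fun z => π.f.eval z)) ((π.X ∘ φ.symm) (φ (π.ι P))) :=
      analyticAt_schwarzian (π.f.differentiable.analyticAt _) (by rw [deriv_eval, hX0]; exact hf)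
    -- At a branch point the extension is the right-hand side of `pullback_eq_of_deriv_Y_ne_zero`:
    -- it divides only by `f'(x)` and, inside `S(Y)`, by `Y'`, neither of which vanishes there.
    refine ⟨_, (((hR.div ((hev π.f.derivative).pow 2) hf2).sub
      (((analyticAt_const (v := κ / 3)).mul (hSf.comp hXa)).mul (hYa.pow 2) |>.div
        ((hev π.f.derivative).pow 2) hf2)).mul (hYa.deriv.pow 2)).add
      ((analyticAt_const (v := κ / 12)).mul (analyticAt_schwarzian hYa hYd)), ?_,
      fun h => absurd hy h⟩
    -- The zero of `Y` is isolated, so the formula in terms of `y` holds on a punctured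
    -- neighbourhood.
    have h1 := hYa.differentiableAt.hasDerivAt.eventually_ne (c := 0) hYd
    have h2 : ∀ᶠ z in 𝓝 (φ (π.ι P)), deriv (π.Y ∘ φ.symm) z ≠ 0 :=
      hYa.deriv.continuousAt.eventually_ne hYd
    have h3 : ∀ᶠ z in 𝓝 (φ (π.ι P)), π.f.derivative.eval ((π.X ∘ φ.symm) z) ≠ 0 :=
      (hev π.f.derivative).continuousAt.eventually_ne (by rwa [hX0])
    filter_upwards [h1, nhdsWithin_le_nhds h2, nhdsWithin_le_nhds h3,
      nhdsWithin_le_nhds (eventually_eq_ι hP)] with z hz1 hz2 hz3 ⟨hz, Q, hQ⟩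
    have hzQ : z = φ (π.ι Q) := by rw [← hQ, φ.right_inv hz]
    have hQs : π.ι Q ∈ φ.source := by rw [← hQ]; exact φ.map_target hz
    have hzX : (π.X ∘ φ.symm) z = Q.x := by rw [Function.comp_apply, hQ, X_ι]
    have hzY : (π.Y ∘ φ.symm) z = Q.y := by rw [Function.comp_apply, hQ, Y_ι]
    rw [hzX] at hz3
    rw [hzY] at hz1
    have := pullback_eq_of_deriv_Y_ne_zero κ θ hφ hQs hz1 (hzQ ▸ hz2) hz3
    rw [← hzQ, hθ Q hz1] at this
    simp only [Pi.add_apply, Pi.mul_apply, Pi.sub_apply, Pi.div_apply, Pi.pow_apply, hzX, hzY,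
      Function.comp_apply, hQ, X_ι] at this ⊢
    exact this
  · have hfX : π.f.eval ((π.X ∘ φ.symm) (φ (π.ι P))) ≠ 0 := by
      rw [hX0]
      exact eval_ne_zero hy
    have key : ∃ g, AnalyticAt ℂ g (φ (π.ι P)) ∧ π.pullback κ θ φ =ᶠ[𝓝 (φ (π.ι P))] g := by
      refine ⟨_, (((((analyticAt_const (v := κ / 32)).mul (((hev π.f.derivative).pow 2).div
        (hev π.f) hfX)).add ((analyticAt_const (v := 1 / 4)).mul hR)).div (hev π.f) hfX).mul
        (hXa.deriv.pow 2)).add ((analyticAt_const (v := κ / 12)).mul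
          (analyticAt_schwarzian hXa (deriv_X_ne_zero hφ hP hy))), ?_⟩
      have h1 : ∀ᶠ z in 𝓝 (φ (π.ι P)), (π.Y ∘ φ.symm) z ≠ 0 :=
        hYa.continuousAt.eventually_ne (by rwa [hY0])
      filter_upwards [h1, eventually_eq_ι hP] with z hz1 ⟨hz, Q, hQ⟩
      have hzX : (π.X ∘ φ.symm) z = Q.x := by rw [Function.comp_apply, hQ, X_ι]
      have hzY : (π.Y ∘ φ.symm) z = Q.y := by rw [Function.comp_apply, hQ, Y_ι]
      rw [hzY] at hz1
      have h2 := hθ Q hz1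
      have h3 : π.f.eval Q.x ≠ 0 := eval_ne_zero hz1
      have h4 : θ (π.ι Q) = (κ / 32 * (π.f.derivative.eval Q.x ^ 2 / π.f.eval Q.x) +
          1 / 4 * (A.eval Q.x + Q.y * B.eval Q.x)) / π.f.eval Q.x := by
        rw [residue] at h2
        rw [eq_div_iff h3, ← h2]
        ring
      simp only [pullback, Pi.add_apply, Pi.mul_apply, Pi.div_apply, Pi.pow_apply, hzX, hzY, hQ,
        h4]
    obtain ⟨g, hg, hg'⟩ := key
    exact ⟨g, hg, nhdsWithin_le_nhds hg', fun _ => hg.continuousAt.congr hg'.symm⟩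

end Patch

/-! ### Comparison of the two patches -/

theorem X_finite (P : AffineCurve H.p) : (finitePatch H).X (Surface.finite P) = P.x :=
  Patch.X_ι (π := finitePatch H) P

theorem Y_finite (P : AffineCurve H.p) : (finitePatch H).Y (Surface.finite P) = P.y :=
  Patch.Y_ι (π := finitePatch H) P

theorem X_ofInfinity (Q : AffineCurve H.q) :
    (infinityPatch H).X (Surface.ofInfinity H Q) = Q.x :=
  Patch.X_ι (π := infinityPatch H) Q

theorem X_finite_eq {P : AffineCurve H.p} {Q : AffineCurve H.q}
    (h : Surface.finite P = Surface.ofInfinity H Q) : P.x ≠ 0 ∧ Q.x = P.x⁻¹ ∧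
      Q.y = P.y / P.x ^ (H.g + 1) :=
  ⟨(Surface.finite_eq_ofInfinity h).1, congrArg Prod.fst (Surface.finite_eq_ofInfinity h).2,
    congrArg Prod.snd (Surface.finite_eq_ofInfinity h).2⟩

/-- With `x = 1 / u` the Schwarzian of inversion vanishes, and `(dx / du) ^ 2 = x ^ 4` is the factor
between `θ` and `θ'`. -/
theorem pullback_infinityPatch (κ : ℂ) {θ θ' : H.Surface → ℂ}
    {φ : OpenPartialHomeomorph H.Surface ℂ}
    (hφ : φ ∈ IsManifold.maximalAtlas 𝓘(ℂ) ω H.Surface) {P : AffineCurve H.p} {Q : AffineCurve H.q}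
    (h : Surface.finite P = Surface.ofInfinity H Q) (hy : P.y ≠ 0)
    (hP : Surface.finite P ∈ φ.source)
    (hθ : θ' (Surface.finite P) = P.x ^ 4 * θ (Surface.finite P)) :
    (finitePatch H).pullback κ θ φ (φ (Surface.finite P)) =
      (infinityPatch H).pullback κ θ' φ (φ (Surface.finite P)) := by
  have hQs : (infinityPatch H).ι Q ∈ φ.source := by
    change Surface.ofInfinity H Q ∈ _
    rwa [← h]
  obtain ⟨hPx, hQx, hQy⟩ := X_finite_eq h
  have hQ0 : Q.x ≠ 0 := by rw [hQx]; exact inv_ne_zero hPx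
  have hQy0 : Q.y ≠ 0 := by rw [hQy]; exact div_ne_zero hy (pow_ne_zero _ hPx)
  have ha := (Patch.analyticAt_coords hφ hQs).1
  have hd := Patch.deriv_X_ne_zero hφ hQs hQy0
  have hX0 : ((infinityPatch H).X ∘ φ.symm) (φ ((infinityPatch H).ι Q)) = Q.x :=
    (Patch.comp_symm_apply hQs _).trans (X_ofInfinity Q)
  have hι : (infinityPatch H).ι Q = Surface.finite P := h.symm
  have hev : (finitePatch H).X ∘ φ.symm =ᶠ[𝓝 (φ (Surface.finite P))]
      (fun z => z⁻¹) ∘ ((infinityPatch H).X ∘ φ.symm) := by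
    have h1 := Patch.eventually_eq_ι (π := finitePatch H) hP
    have h2 := Patch.eventually_eq_ι hQs
    rw [hι] at h2
    filter_upwards [h1, h2] with z ⟨_, P', hP'⟩ ⟨_, Q', hQ'⟩
    have h3 := X_finite_eq (hP'.symm.trans hQ')
    have h4 : (infinityPatch H).X (φ.symm z) = Q'.x := by
      rw [hQ']
      exact X_ofInfinity Q'
    have h5 : (finitePatch H).X (φ.symm z) = P'.x := by
      rw [hP']
      exact X_finite P'
    simp only [Function.comp_apply]
    rw [h4, h5, h3.2.1, inv_inv]
  rw [hι] at ha hd hX0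
  have hia : AnalyticAt ℂ (fun z : ℂ => z⁻¹) (((infinityPatch H).X ∘ φ.symm) (φ (.finite P))) := by
    rw [hX0]
    exact analyticAt_inv hQ0
  have hid : deriv (fun z : ℂ => z⁻¹) Q.x = -(Q.x ^ 2)⁻¹ := congrFun deriv_inv' _
  rw [Patch.pullback, Patch.pullback, hev.deriv_eq, hev.schwarzian_eq,
    schwarzian_comp hia ha (by rw [hX0, hid]; simpa using hQ0) hd,
    deriv_comp _ hia.differentiableAt ha.differentiableAt, hX0, hid, schwarzian_inv hQ0,
    φ.left_inv hP, hθ, hQx]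
  field_simp
  ring

/-- Put `N = 2 g + 2`. From `q(u) = u ^ N p(1 / u)` one gets `x ^ (2 g) q' ^ 2 / q = (N p - x p') ^
2 / p`. Its only non-polynomial term `x ^ 2 p' ^ 2 / p` belongs to the polar part for `p`; the other
terms give the correction. -/
theorem residue_infinityPatch (κ : ℂ) {θ θ' : H.Surface → ℂ} {P : AffineCurve H.p}
    {Q : AffineCurve H.q} (h : Surface.finite P = Surface.ofInfinity H Q) (hy : P.y ≠ 0)
    (hθ : θ' (Surface.finite P) = P.x ^ 4 * θ (Surface.finite P)) :
    P.x ^ (2 * H.g) * (infinityPatch H).residue κ θ' Q =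
      P.x ^ 2 * (finitePatch H).residue κ θ P - κ / 8 * ((2 * H.g + 2) ^ 2 * H.p.eval P.x -
        2 * (2 * H.g + 2) * P.x * H.p.derivative.eval P.x) := by
  obtain ⟨hPx, hQx, hQy⟩ := X_finite_eq h
  have hQ0 : Q.x ≠ 0 := by rw [hQx]; exact inv_ne_zero hPx
  have hp : H.p.eval P.x ≠ 0 := Patch.eval_ne_zero (π := finitePatch H) hy
  have h1 : H.q.derivative.eval Q.x = ((2 * H.g + 2 : ℕ) : ℂ) * Q.x ^ (2 * H.g + 1) * H.p.eval P.x
      + Q.x ^ (2 * H.g + 2) * (H.p.derivative.eval P.x * (-(Q.x ^ 2)⁻¹)) := by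
    have h2 : HasDerivAt (fun u => u ^ (2 * H.g + 2) * H.p.eval u⁻¹)
        (((2 * H.g + 2 : ℕ) : ℂ) * Q.x ^ (2 * H.g + 2 - 1) * H.p.eval Q.x⁻¹ +
          Q.x ^ (2 * H.g + 2) * (H.p.derivative.eval Q.x⁻¹ * (-(Q.x ^ 2)⁻¹))) Q.x :=
      (hasDerivAt_pow _ Q.x).mul ((H.p.hasDerivAt Q.x⁻¹).comp Q.x (hasDerivAt_inv hQ0))
    have h3 := (H.q.hasDerivAt Q.x).unique (h2.congr_of_eventuallyEq (by
      filter_upwards [isOpen_ne.mem_nhds hQ0] with u hu using H.eval_q hu))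
    rw [h3, show Q.x⁻¹ = P.x by rw [hQx, inv_inv]]
    rfl
  have h2 : H.q.eval Q.x = Q.x ^ (2 * H.g + 2) * H.p.eval P.x := by
    rw [H.eval_q hQ0, show Q.x⁻¹ = P.x by rw [hQx, inv_inv]]
  change P.x ^ (2 * H.g) * (4 * (H.q.eval Q.x * θ' (Surface.ofInfinity H Q) -
    κ / 32 * (H.q.derivative.eval Q.x ^ 2 / H.q.eval Q.x))) = P.x ^ 2 * (4 * (H.p.eval P.x *
    θ (Surface.finite P) - κ / 32 * (H.p.derivative.eval P.x ^ 2 / H.p.eval P.x))) - _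
  rw [← h, hθ, h1, h2, hQx]
  push_cast
  simp only [inv_pow, pow_add]
  field_simp
  ring

end HyperellipticEquation

/-! ### Gluing projective connections into a one-point function -/

namespace HyperellipticEquation

variable {H : HyperellipticEquation}

/-- The chain rule for `S` makes every pullback obey the Virasoro transformation rule, whatever `θ`
is. -/
theorem Patch.pullback_transition {π : Patch H} (κ : ℂ) (θ : H.Surface → ℂ)
    {φ ψ : OpenPartialHomeomorph H.Surface ℂ}
    (hφ : φ ∈ IsManifold.maximalAtlas 𝓘(ℂ) ω H.Surface)
    (hψ : ψ ∈ IsManifold.maximalAtlas 𝓘(ℂ) ω H.Surface) {P : AffineCurve π.f} (hy : P.y ≠ 0)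
    (hP : π.ι P ∈ φ.source) (hP' : π.ι P ∈ ψ.source) :
    π.pullback κ θ φ (φ (π.ι P)) =
      π.pullback κ θ ψ (ψ (π.ι P)) * deriv (ψ ∘ φ.symm) (φ (π.ι P)) ^ 2 +
        κ / 12 * schwarzian (ψ ∘ φ.symm) (φ (π.ι P)) := by
  have h0 : (ψ ∘ φ.symm) (φ (π.ι P)) = ψ (π.ι P) := Patch.comp_symm_apply hP _
  have hev := transition_comp_eventuallyEq hP hP' π.X
  have hX := (Patch.analyticAt_coords hψ hP').1
  have hX' := Patch.deriv_X_ne_zero hψ hP' hy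
  have hτ := analyticAt_transition hφ hψ hP hP'
  rw [← h0] at hX hX'
  rw [Patch.pullback, Patch.pullback, hev.deriv_eq, hev.schwarzian_eq,
    schwarzian_comp hX hτ hX' (deriv_transition_ne_zero hφ hψ hP hP'),
    deriv_comp _ hX.differentiableAt hτ.differentiableAt, h0, φ.left_inv hP, ψ.left_inv hP']
  ring

theorem exists_infinite_eq (w : ℂ) (hw : w ^ 2 = H.p.coeff (2 * H.g + 2)) :
    ∃ Q, Surface.infinite w hw = Surface.ofInfinity H Q ∧ Q.x = 0 ∧ Q.y = w := by
  have h := Surface.ofInfinity_zero (H := H) (Q := ⟨0, w, hw.trans H.eval_q_zero.symm⟩) rfl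
  exact ⟨_, h.symm, rfl, rfl⟩

/-- The coordinate `x` is a local coordinate away from a discrete set. -/
theorem eventually_mem_xDomain {φ : OpenPartialHomeomorph H.Surface ℂ}
    (hφ : φ ∈ IsManifold.maximalAtlas 𝓘(ℂ) ω H.Surface) {s : H.Surface} (hs : s ∈ φ.source) :
    ∀ᶠ z in 𝓝[≠] φ s, z ∈ φ.target ∧
      ∃ P : AffineCurve H.p, P.y ≠ 0 ∧ φ.symm z = Surface.finite P := by
  cases s with
  | finite P =>
    have hP : (finitePatch H).ι P ∈ φ.source := hs
    obtain ⟨-, hYa⟩ := Patch.analyticAt_coords hφ hP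
    have h1 : ∀ᶠ z in 𝓝[≠] φ (Surface.finite P), ((finitePatch H).Y ∘ φ.symm) z ≠ 0 := by
      by_cases hy : P.y = 0
      · exact hYa.differentiableAt.hasDerivAt.eventually_ne (Patch.deriv_Y_ne_zero hφ hP hy)
      · refine nhdsWithin_le_nhds (hYa.continuousAt.eventually_ne ?_)
        rw [Patch.comp_symm_apply hP]
        exact fun h => hy ((Y_finite P).symm.trans h)
    filter_upwards [h1, nhdsWithin_le_nhds (Patch.eventually_eq_ι hP)] with z hz ⟨hz', Q, hQ⟩
    refine ⟨hz', Q, ?_, hQ⟩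
    rw [Function.comp_apply, hQ] at hz
    exact fun h => hz ((Y_finite Q).trans h)
  | infinite w hw =>
    obtain ⟨Q, hQ, hQ0, -⟩ := exists_infinite_eq w hw
    rw [hQ] at hs ⊢
    have hP : (infinityPatch H).ι Q ∈ φ.source := hs
    obtain ⟨hXa, hYa⟩ := Patch.analyticAt_coords hφ hP
    have h1 : ∀ᶠ z in 𝓝[≠] φ (Surface.ofInfinity H Q), ∀ Q' : AffineCurve H.q,
        φ.symm z = Surface.ofInfinity H Q' → Q'.x ≠ 0 ∧ Q'.y ≠ 0 := by
      by_cases hy : Q.y = 0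
      -- Here `q(0) = 0`: infinity is a branch point and the local coordinate is `w`. Since `u = 0`
      -- forces `w = 0`, it is enough to avoid `w = 0`.
      · filter_upwards [hYa.differentiableAt.hasDerivAt.eventually_ne (c := 0)
          (Patch.deriv_Y_ne_zero hφ hP hy)] with z hz Q' hQ'
        rw [Function.comp_apply, hQ'] at hz
        have hy' : Q'.y ≠ 0 := fun h => hz ((Patch.Y_ι (π := infinityPatch H) Q').trans h)
        refine ⟨fun h => hy' ?_, hy'⟩
        have h2 := Q'.y_sq
        rw [h, ← hQ0, ← Q.y_sq, hy] at h2
        simpa using h2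
      · have h2 : ∀ᶠ z in 𝓝 (φ (Surface.ofInfinity H Q)), ((infinityPatch H).Y ∘ φ.symm) z ≠ 0 := by
          refine hYa.continuousAt.eventually_ne ?_
          rw [Patch.comp_symm_apply hP]
          exact fun h => hy ((Patch.Y_ι (π := infinityPatch H) Q).symm.trans h)
        filter_upwards [hXa.differentiableAt.hasDerivAt.eventually_ne (c := 0)
          (Patch.deriv_X_ne_zero hφ hP hy), nhdsWithin_le_nhds h2] with z hz hz' Q' hQ'
        rw [Function.comp_apply, hQ'] at hz hz'
        exact ⟨fun h => hz ((X_ofInfinity Q').trans h),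
          fun h => hz' ((Patch.Y_ι (π := infinityPatch H) Q').trans h)⟩
    filter_upwards [h1, nhdsWithin_le_nhds (Patch.eventually_eq_ι hP)] with z hz ⟨hz', Q', hQ'⟩
    obtain ⟨hx, hy⟩ := hz Q' hQ'
    obtain ⟨P, hP⟩ := Surface.exists_finite Q' hx
    refine ⟨hz', P, fun h => hy ?_, hQ'.trans hP⟩
    rw [(X_finite_eq hP.symm).2.2, h, zero_div]

/-- Projective connections on the two patches that agree on the overlap define a one-point
function. -/
theorem exists_virasoroOnePoint {c Z : ℂ} {θ θ' : H.Surface → ℂ} {A B A' B' : ℂ[X]}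
    (hθ : ∀ P : AffineCurve H.p, P.y ≠ 0 →
      (finitePatch H).residue (c * Z) θ P = A.eval P.x + P.y * B.eval P.x)
    (hθ' : ∀ Q : AffineCurve H.q, Q.y ≠ 0 →
      (infinityPatch H).residue (c * Z) θ' Q = A'.eval Q.x + Q.y * B'.eval Q.x)
    (hc : ∀ P : AffineCurve H.p, P.x ≠ 0 → P.y ≠ 0 →
      θ' (Surface.finite P) = P.x ^ 4 * θ (Surface.finite P)) :
    ∃ T : VirasoroOnePoint H.Surface c Z, ∀ P : H.XDomain, T.atX P = θ (Surface.finite P.1) := by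
  have key : ∀ φ ∈ IsManifold.maximalAtlas 𝓘(ℂ) ω H.Surface, ∀ s ∈ φ.source,
      ∃ g, AnalyticAt ℂ g (φ s) ∧
        limExtend ((finitePatch H).pullback (c * Z) θ φ) =ᶠ[𝓝 (φ s)] g := by
    intro φ hφ s hs
    suffices h : ∃ g, AnalyticAt ℂ g (φ s) ∧ (finitePatch H).pullback (c * Z) θ φ =ᶠ[𝓝[≠] φ s] g by
      obtain ⟨g, hg, hg'⟩ := h
      exact ⟨g, hg, limExtend_eventuallyEq hg hg'⟩
    cases s with
    | finite P =>
      obtain ⟨g, hg, hg', -⟩ := Patch.exists_analyticAt_pullback (π := finitePatch H) hθ hφ hs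
      exact ⟨g, hg, hg'⟩
    | infinite w hw =>
      obtain ⟨Q, hQ, -⟩ := exists_infinite_eq w hw
      rw [hQ] at hs ⊢
      have hP : (infinityPatch H).ι Q ∈ φ.source := hs
      obtain ⟨g, hg, hg', -⟩ := Patch.exists_analyticAt_pullback hθ' hφ hP
      refine ⟨g, hg, EventuallyEq.trans ?_ hg'⟩
      filter_upwards [eventually_mem_xDomain hφ hs, nhdsWithin_le_nhds (Patch.eventually_eq_ι hP)]
        with z ⟨hz, P, hPy, hzP⟩ ⟨_, Q', hQ'⟩
      have h := hzP.symm.trans hQ'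
      have hzP' : z = φ (Surface.finite P) := by rw [← hzP, φ.right_inv hz]
      rw [hzP']
      exact pullback_infinityPatch _ hφ h hPy (hzP ▸ φ.map_target hz) (hc P (X_finite_eq h).1 hPy)
  have hval : ∀ φ ∈ IsManifold.maximalAtlas 𝓘(ℂ) ω H.Surface, ∀ P : AffineCurve H.p, P.y ≠ 0 →
      Surface.finite P ∈ φ.source →
      limExtend ((finitePatch H).pullback (c * Z) θ φ) (φ (Surface.finite P)) =
        (finitePatch H).pullback (c * Z) θ φ (φ (Surface.finite P)) := by
    intro φ hφ P hy hs
    obtain ⟨-, -, -, h⟩ := Patch.exists_analyticAt_pullback (π := finitePatch H) hθ hφ hs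
    exact limExtend_eq (h hy)
  -- The bare pullback has meaningless values at branch points and at infinity; punctured limits
  -- replace them and change nothing where `y ≠ 0`.
  refine ⟨⟨fun φ => limExtend ((finitePatch H).pullback (c * Z) θ φ), ?_, ?_⟩, ?_⟩
  · intro φ hφ z hz
    obtain ⟨g, hg, hg'⟩ := key φ hφ _ (φ.map_target hz)
    rw [φ.right_inv hz] at hg hg'
    exact (hg.congr hg'.symm).differentiableAt.differentiableWithinAt
  · rintro φ hφ ψ hψ s ⟨hs, hs'⟩
    obtain ⟨g, hg, hg'⟩ := key φ hφ s hs
    obtain ⟨h, hh, hh'⟩ := key ψ hψ s hs'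
    have h0 : (ψ ∘ φ.symm) (φ s) = ψ s := by rw [Function.comp_apply, φ.left_inv hs]
    have hτ := analyticAt_transition hφ hψ hs hs'
    have hS := analyticAt_schwarzian hτ (deriv_transition_ne_zero hφ hψ hs hs')
    have hψa := hh.congr hh'.symm
    rw [← h0] at hψa
    have hl := ((hψa.comp hτ).mul (hτ.deriv.pow 2)).continuousAt.tendsto.mono_left
      (nhdsWithin_le_nhds (s := {φ s}ᶜ))
    have hr := ((hg.congr hg'.symm).sub (((analyticAt_const (v := c / 12)).mul hS).mul
      (analyticAt_const (v := Z)))).continuousAt.tendsto.mono_left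
      (nhdsWithin_le_nhds (s := {φ s}ᶜ))
    -- Both sides of the transformation rule are continuous and agree at the finite points with `y ≠
    -- 0`, which fill a punctured neighbourhood of `s`.
    have heq := tendsto_nhds_unique_of_eventuallyEq hl hr ?_
    · simpa [φ.left_inv hs] using heq
    · have hψs : ∀ᶠ z in 𝓝 (φ s), φ.symm z ∈ ψ.source := by
        refine (φ.continuousAt_symm (φ.map_source hs)).eventually (ψ.open_source.mem_nhds ?_)
        rwa [φ.left_inv hs]
      filter_upwards [eventually_mem_xDomain hφ hs, nhdsWithin_le_nhds hψs]
        with z ⟨hz, P, hPy, hzP⟩ hzψ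
      have hPφ : Surface.finite P ∈ φ.source := hzP ▸ φ.map_target hz
      rw [hzP] at hzψ
      obtain rfl : z = φ (Surface.finite P) := by rw [← hzP, φ.right_inv hz]
      have h1 : (finitePatch H).pullback (c * Z) θ φ (φ (Surface.finite P)) =
          (finitePatch H).pullback (c * Z) θ ψ (ψ (Surface.finite P)) *
            deriv (ψ ∘ φ.symm) (φ (Surface.finite P)) ^ 2 +
          c * Z / 12 * schwarzian (ψ ∘ φ.symm) (φ (Surface.finite P)) :=
        Patch.pullback_transition (π := finitePatch H) (c * Z) θ hφ hψ hPy hPφ hzψ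
      have h2 := hval φ hφ P hPy hPφ
      have h3 := hval ψ hψ P hPy hzψ
      simp only [Pi.mul_apply, Pi.pow_apply, Pi.sub_apply, Function.comp_apply, hzP, h2, h3]
      linear_combination -h1
  · rintro ⟨P, hy⟩
    have hs := Patch.mem_xChart_source (π := finitePatch H) hy
    have h1 := hval _ Patch.chart_mem_maximalAtlas P hy hs
    have h2 := Patch.pullback_xChart (π := finitePatch H) (hb := hy) (c * Z) θ
      (Patch.mem_chart_source.1 hs)
    have h3 := Patch.chart_apply (π := finitePatch H)
      (he := Patch.xChart_mem (finitePatch H).f P.y hy) P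
    change Patch.chart _ _ _ (Surface.finite P) = P.x at h3
    rw [h3] at h1
    exact h1.trans h2

end HyperellipticEquation

/-! ### The one-point function in the coordinate of each patch -/

namespace VirasoroOnePoint

open HyperellipticEquation

variable {H : HyperellipticEquation} {c Z : ℂ} (T : VirasoroOnePoint H.Surface c Z)

open Classical in
/-- The one-point function in the coordinate `x` of a patch, with the value zero at the branch
points. -/
def xValue (π : Patch H) (s : H.Surface) : ℂ :=
  if h : π.Y s ≠ 0 then
    T.T (π.chart (AffineCurve.xChart π.f (π.Y s) h) (Patch.xChart_mem _ _ _)) (π.X s)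
  else 0

theorem xValue_ι {π : Patch H} {P : AffineCurve π.f} (hy : P.y ≠ 0) :
    T.xValue π (π.ι P) =
      T.T (π.chart (AffineCurve.xChart π.f P.y hy) (Patch.xChart_mem _ _ _)) P.x := by
  have h : π.Y (π.ι P) ≠ 0 := by rwa [Patch.Y_ι]
  rw [xValue, dif_pos h, Patch.X_ι]
  congr 3
  exact Patch.Y_ι P

theorem atX_eq (P : H.XDomain) : T.atX P = T.xValue (finitePatch H) (Surface.finite P.1) :=
  (T.xValue_ι (π := finitePatch H) P.2).symm

/-- This is the transformation rule from `φ` to the coordinate `x`, solved for `T.T φ`. -/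
theorem eq_pullback {π : Patch H} {P : AffineCurve π.f} (hy : P.y ≠ 0)
    {φ : OpenPartialHomeomorph H.Surface ℂ}
    (hφ : φ ∈ IsManifold.maximalAtlas 𝓘(ℂ) ω H.Surface) (hP : π.ι P ∈ φ.source) :
    T.T φ (φ (π.ι P)) = π.pullback (c * Z) (T.xValue π) φ (φ (π.ι P)) := by
  have hs := Patch.mem_xChart_source hy
  have h := T.transform φ hφ _ Patch.chart_mem_maximalAtlas _ ⟨hP, hs⟩
  have hev : π.chart (AffineCurve.xChart π.f P.y hy) (Patch.xChart_mem _ _ _) ∘ φ.symm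
      =ᶠ[𝓝 (φ (π.ι P))] π.X ∘ φ.symm := by
    filter_upwards [Patch.eventually_eq_ι hP] with z ⟨_, Q, hQ⟩
    simp only [Function.comp_apply, hQ, Patch.chart_apply, Patch.X_ι]
    rfl
  rw [hev.deriv_eq, hev.schwarzian_eq, Patch.chart_apply] at h
  rw [Patch.pullback, φ.left_inv hP, T.xValue_ι hy]
  refine (eq_add_of_sub_eq' h.symm).trans ?_
  change _ + T.T _ P.x * _ = _
  ring

/-- `xValue` uses a different sheet chart at each point. All of them have coordinate `x`, so the
value does not depend on the choice, and holomorphy can be tested in one fixed chart. -/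
theorem xValue_eq_of_re_pos {π : Patch H} {P : AffineCurve π.f} {b : ℂ} {hb : b ≠ 0}
    (hP : 0 < (P.y / b).re) :
    T.xValue π (π.ι P) =
      T.T (π.chart (AffineCurve.xChart π.f b hb) (Patch.xChart_mem _ _ _)) P.x := by
  have hy : P.y ≠ 0 := by
    rintro h
    simp [h] at hP
  have hs : π.ι P ∈ (π.chart (AffineCurve.xChart π.f b hb) (Patch.xChart_mem _ _ _)).source :=
    Patch.mem_chart_source.2 hP
  have h := T.eq_pullback hy Patch.chart_mem_maximalAtlas hs
  rw [Patch.chart_apply] at h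
  exact (Patch.pullback_xChart _ _ hP).symm.trans h.symm

/-- In the chart with coordinate `u`, the same value of `T` is a pullback from either patch;
comparing the two by `pullback_infinityPatch` gives the factor. -/
theorem xValue_infinityPatch {P : AffineCurve H.p} (hx : P.x ≠ 0) (hy : P.y ≠ 0) :
    T.xValue (infinityPatch H) (Surface.finite P) =
      P.x ^ 4 * T.xValue (finitePatch H) (Surface.finite P) := by
  obtain ⟨Q, hQ⟩ := Surface.exists_ofInfinity P hx
  have hQy : Q.y ≠ 0 := by
    rw [(X_finite_eq hQ).2.2]
    exact div_ne_zero hy (pow_ne_zero _ hx)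
  have hs := Patch.mem_xChart_source (π := infinityPatch H) hQy
  have hs' : Surface.finite P ∈ ((infinityPatch H).chart
      (AffineCurve.xChart (infinityPatch H).f Q.y hQy) (Patch.xChart_mem _ _ _)).source := by
    rw [hQ]
    exact hs
  have h1 := T.eq_pullback (π := infinityPatch H) hQy Patch.chart_mem_maximalAtlas hs
  have h2 := T.eq_pullback (π := finitePatch H) hy Patch.chart_mem_maximalAtlas hs'
  have h3 := pullback_infinityPatch (c * Z) (θ := T.xValue (finitePatch H))
    (θ' := fun s => (finitePatch H).X s ^ 4 * T.xValue (finitePatch H) s)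
    Patch.chart_mem_maximalAtlas hQ hy hs' (by simp only [X_finite])
  have h4 : ∀ θ, (infinityPatch H).pullback (c * Z) θ
      ((infinityPatch H).chart (AffineCurve.xChart (infinityPatch H).f Q.y hQy)
        (Patch.xChart_mem _ _ _)) Q.x = θ (Surface.ofInfinity H Q) := fun θ =>
    Patch.pullback_xChart (π := infinityPatch H) (hb := hQy) (c * Z) θ
      (Patch.mem_chart_source.1 hs)
  have h5 : (infinityPatch H).chart (AffineCurve.xChart (infinityPatch H).f Q.y hQy)
        (Patch.xChart_mem _ _ _) (Surface.finite P) = Q.x := by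
    rw [hQ]
    exact Patch.chart_apply (π := infinityPatch H) Q
  have h8 : (infinityPatch H).ι Q = Surface.finite P := hQ.symm
  rw [h5, h4, ← hQ, X_finite] at h3
  rw [h8, h5, h4, ← hQ] at h1
  rw [← h1, ← h3, ← h5]
  exact h2

end VirasoroOnePoint

/-! ### Even and odd parts under the hyperelliptic involution -/

namespace AffineCurve

variable {f : ℂ[X]}

/-- The hyperelliptic involution. -/
def conj (P : AffineCurve f) : AffineCurve f := ⟨P.x, -P.y, by rw [neg_sq, P.y_sq]⟩

theorem eq_or_eq_conj {P Q : AffineCurve f} (h : P.x = Q.x) : P = Q ∨ P = Q.conj := by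
  have h1 : P.y ^ 2 = Q.y ^ 2 := by rw [P.y_sq, Q.y_sq, h]
  rcases sq_eq_sq_iff_eq_or_eq_neg.1 h1 with h2 | h2
  · exact Or.inl (AffineCurve.ext h h2)
  · exact Or.inr (AffineCurve.ext h h2)

theorem conj_conj (P : AffineCurve f) : P.conj.conj = P := AffineCurve.ext rfl (neg_neg _)

theorem y_ne_zero_iff (P : AffineCurve f) : P.y ≠ 0 ↔ f.eval P.x ≠ 0 := by
  rw [← P.y_sq]
  simp

/-- The Galois-even part of a function on the curve. -/
def evenPart (F : AffineCurve f → ℂ) (x : ℂ) : ℂ := (F (lift f x) + F (lift f x).conj) / 2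

/-- The Galois-odd part of a function on the curve, divided by `y`. -/
def oddPart (F : AffineCurve f → ℂ) (x : ℂ) : ℂ :=
  (F (lift f x) - F (lift f x).conj) / (2 * (lift f x).y)

/-- The expression is symmetric in the two points over `x`, so the root chosen by `lift`, which is
discontinuous in `x`, does not matter. -/
theorem evenPart_eq (F : AffineCurve f → ℂ) (P : AffineCurve f) :
    evenPart F P.x = (F P + F P.conj) / 2 := by
  rcases eq_or_eq_conj (P := lift f P.x) (Q := P) rfl with h | h
  · rw [evenPart, h]
  · rw [evenPart, h, conj_conj, add_comm]

theorem oddPart_eq (F : AffineCurve f → ℂ) (P : AffineCurve f) :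
    oddPart F P.x = (F P - F P.conj) / (2 * P.y) := by
  rcases eq_or_eq_conj (P := lift f P.x) (Q := P) rfl with h | h
  · rw [oddPart, h]
  · rw [oddPart, h, conj_conj]
    change (F P.conj - F P) / (2 * -P.y) = _
    rw [← neg_sub, mul_neg, neg_div_neg_eq]

theorem xChart_symm_neg {b : ℂ} (hb : b ≠ 0) (x : ℂ) :
    (xChart f (-b) (neg_ne_zero.2 hb)).symm x = ((xChart f b hb).symm x).conj := by
  refine AffineCurve.ext rfl ?_
  change -b * (f.eval x / (-b) ^ 2).sqrt = -(b * (f.eval x / b ^ 2).sqrt)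
  rw [neg_sq, neg_mul]

theorem mem_xChart_target {a b : ℂ} (hb : b ≠ 0) (h : b ^ 2 = f.eval a) :
    a ∈ (xChart f b hb).target := by
  change f.eval a / b ^ 2 ∈ Complex.slitPlane
  rw [← h, div_self (pow_ne_zero _ hb)]
  exact Complex.one_mem_slitPlane

/-- The charts for `b` and `-b` parametrize the two sheets over a neighbourhood of `a` and are
exchanged by `conj`, so `F` and `F ∘ conj` are both holomorphic in `x` there. -/
theorem differentiableAt_parts {F : AffineCurve f → ℂ}
    (hF : ∀ b hb, DifferentiableOn ℂ (fun x => F ((xChart f b hb).symm x)) (xChart f b hb).target)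
    {a : ℂ} (ha : f.eval a ≠ 0) :
    DifferentiableAt ℂ (evenPart F) a ∧ DifferentiableAt ℂ (oddPart F) a := by
  set b := (f.eval a).sqrt
  have hb2 : b ^ 2 = f.eval a := csqrt_sq _
  have hb : b ≠ 0 := by
    rintro h
    rw [h] at hb2
    exact ha (by simpa using hb2.symm)
  have hn := nice_of_mem (f := f) (Or.inl ⟨b, hb, rfl⟩)
  have hmem := mem_xChart_target hb hb2
  have hmem' := mem_xChart_target (f := f) (neg_ne_zero.2 hb) (by rwa [neg_sq])
  have h1 := (hF b hb).differentiableAt (hn.open_target.mem_nhds hmem)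
  have h2 := (hF (-b) (neg_ne_zero.2 hb)).differentiableAt
    ((nice_of_mem (f := f) (Or.inl ⟨-b, _, rfl⟩)).open_target.mem_nhds hmem')
  have hy : DifferentiableAt ℂ (fun x => ((xChart f b hb).symm x).y) a :=
    (hn.diff.differentiableAt (hn.open_target.mem_nhds hmem)).snd
  rw [funext fun x => congrArg F (xChart_symm_neg hb x)] at h2
  have hy0 : 2 * ((xChart f b hb).symm a).y ≠ 0 :=
    mul_ne_zero two_ne_zero ((y_ne_zero_iff _).2 ha)
  refine ⟨((h1.add h2).div_const 2).congr_of_eventuallyEq (Eventually.of_forall fun x => ?_),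
    ((h1.sub h2).div (hy.const_mul 2) hy0).congr_of_eventuallyEq
      (Eventually.of_forall fun x => ?_)⟩
  · exact evenPart_eq F ((xChart f b hb).symm x)
  · exact oddPart_eq F ((xChart f b hb).symm x)

/-- Since `(y - b) (y + b) = f(x) - f(a)`, a point with `x` close to `a` has `y` close to `b` or to
`-b`. -/
theorem comap_x_le (a b : ℂ) (h : b ^ 2 = f.eval a) :
    comap (x : AffineCurve f → ℂ) (𝓝 a) ≤
      comap coords (𝓝 (a, b)) ⊔ comap coords (𝓝 (a, -b)) := by
  intro s hs
  obtain ⟨⟨t₁, ht₁, h₁⟩, ⟨t₂, ht₂, h₂⟩⟩ := hs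
  rw [nhds_prod_eq, Filter.mem_prod_iff] at ht₁ ht₂
  obtain ⟨u₁, hu₁, v₁, hv₁, hs₁⟩ := ht₁
  obtain ⟨u₂, hu₂, v₂, hv₂, hs₂⟩ := ht₂
  obtain ⟨ε₁, hε₁, hb₁⟩ := Metric.mem_nhds_iff.1 hv₁
  obtain ⟨ε₂, hε₂, hb₂⟩ := Metric.mem_nhds_iff.1 hv₂
  have hc : ∀ᶠ t in 𝓝 a, dist (f.eval t) (f.eval a) < ε₁ * ε₂ :=
    f.continuous.continuousAt.eventually (Metric.ball_mem_nhds _ (mul_pos hε₁ hε₂))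
  refine ⟨_, inter_mem (inter_mem hu₁ hu₂) hc, ?_⟩
  rintro P ⟨⟨hP₁, hP₂⟩, hP⟩
  have hP' : ‖P.y - b‖ * ‖P.y - -b‖ < ε₁ * ε₂ := by
    rw [← norm_mul, show (P.y - b) * (P.y - -b) = P.y ^ 2 - b ^ 2 by ring, P.y_sq, h]
    simpa [dist_eq_norm] using hP
  by_cases h1 : ‖P.y - b‖ < ε₁
  · exact h₁ (hs₁ ⟨hP₁, hb₁ (by rw [Metric.mem_ball, dist_eq_norm]; exact h1)⟩)
  · by_cases h2 : ‖P.y - -b‖ < ε₂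
    · exact h₂ (hs₂ ⟨hP₂, hb₂ (by rw [Metric.mem_ball, dist_eq_norm]; exact h2)⟩)
    · push Not at h1 h2
      exact absurd hP' (not_lt.2 (mul_le_mul h1 h2 hε₂.le (norm_nonneg _)))

/-- A holomorphic function on the curve without the branch points that is bounded near the branch
points is of the form `A x + y B x` with entire functions `A` and `B`. -/
theorem exists_entire (hf : ∀ a, f.eval a = 0 → f.derivative.eval a ≠ 0) {F : AffineCurve f → ℂ}
    (hF : ∀ b hb, DifferentiableOn ℂ (fun x => F ((xChart f b hb).symm x)) (xChart f b hb).target)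
    (hb : ∀ a, f.eval a = 0 →
      ∃ C, ∀ᶠ P in comap x (𝓝 a), P.y ≠ 0 → ‖F P‖ ≤ C) :
    ∃ A B : ℂ → ℂ, Differentiable ℂ A ∧ Differentiable ℂ B ∧
      ∀ P : AffineCurve f, P.y ≠ 0 →
        A P.x = (F P + F P.conj) / 2 ∧ B P.x = (F P - F P.conj) / (2 * P.y) := by
  have hne : ∀ a, ∀ᶠ z in 𝓝[≠] a, f.eval z ≠ 0 := by
    intro a
    by_cases ha : f.eval a = 0
    · exact (f.hasDerivAt a).eventually_ne (hf a ha)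
    · exact nhdsWithin_le_nhds (f.continuous.continuousAt.eventually_ne ha)
  have hdiff : ∀ a, ∀ᶠ z in 𝓝[≠] a,
      DifferentiableAt ℂ (evenPart F) z ∧ DifferentiableAt ℂ (oddPart F) z := fun a =>
    (hne a).mono fun z hz => differentiableAt_parts hF hz
  have hdiff' : ∀ a, f.eval a ≠ 0 → ∀ᶠ z in 𝓝 a,
      DifferentiableAt ℂ (evenPart F) z ∧ DifferentiableAt ℂ (oddPart F) z := fun a ha =>
    (f.continuous.continuousAt.eventually_ne ha).mono fun z hz => differentiableAt_parts hF hz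
  have hbound : ∀ a, f.eval a = 0 → ∃ C, ∀ᶠ z in 𝓝[≠] a,
      ‖F (lift f z)‖ ≤ C ∧ ‖F (lift f z).conj‖ ≤ C := by
    intro a ha
    obtain ⟨C, hC⟩ := hb a ha
    obtain ⟨U, hU, hUC⟩ := hC
    refine ⟨C, ?_⟩
    filter_upwards [hne a, nhdsWithin_le_nhds hU] with z hz hzU
    have hy : (lift f z).y ≠ 0 := (y_ne_zero_iff _).2 hz
    exact ⟨hUC (show (lift f z).x ∈ U from hzU) hy,
      hUC (show (lift f z).conj.x ∈ U from hzU) (neg_ne_zero.2 hy)⟩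
  have hsub : ∀ a : ℂ, Tendsto (fun z => z - a) (𝓝[≠] a) (𝓝 0) := by
    intro a
    have : Tendsto (fun z => z - a) (𝓝 a) (𝓝 (a - a)) :=
      (continuous_id.sub continuous_const).tendsto a
    rw [sub_self] at this
    exact this.mono_left nhdsWithin_le_nhds
  have hA : ∀ a, ∃ g, AnalyticAt ℂ g a ∧ evenPart F =ᶠ[𝓝[≠] a] g := by
    intro a
    by_cases ha : f.eval a = 0
    · refine exists_analyticAt_of_isLittleO ((hdiff a).mono fun z hz => hz.1) ?_
      obtain ⟨C, hC⟩ := hbound a ha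
      refine (hsub a).zero_mul_isBoundedUnder_le ⟨C, ?_⟩
      rw [eventually_map]
      filter_upwards [hC] with z ⟨h1, h2⟩
      simp only [Function.comp_apply, evenPart, norm_div, Complex.norm_ofNat]
      linarith [norm_add_le (F (lift f z)) (F (lift f z).conj)]
    · exact ⟨_, Complex.analyticAt_iff_eventually_differentiableAt.2 ((hdiff' a ha).mono fun z hz => hz.1),
        EventuallyEq.rfl⟩
  have hB : ∀ a, ∃ g, AnalyticAt ℂ g a ∧ oddPart F =ᶠ[𝓝[≠] a] g := by
    intro a
    by_cases ha : f.eval a = 0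
    · refine exists_analyticAt_of_isLittleO ((hdiff a).mono fun z hz => hz.2) ?_
      obtain ⟨C, hC⟩ := hbound a ha
      have h1 : Tendsto (fun z => (z - a) / f.eval z) (𝓝[≠] a) (𝓝 (f.derivative.eval a)⁻¹) := by
        have := (hasDerivAt_iff_tendsto_slope.1 (f.hasDerivAt a)).inv₀ (hf a ha)
        refine this.congr fun z => ?_
        rw [slope_def_field, ha, sub_zero, inv_div]
      have h2 : Tendsto (fun z => (lift f z).y) (𝓝[≠] a) (𝓝 0) := by
        rw [tendsto_zero_iff_norm_tendsto_zero]
        have h3 : Tendsto (fun z => √‖f.eval z‖) (𝓝[≠] a) (𝓝 (√‖f.eval a‖)) :=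
          (f.continuous.norm.sqrt.tendsto a).mono_left nhdsWithin_le_nhds
        rw [ha, norm_zero, Real.sqrt_zero] at h3
        refine h3.congr fun z => ?_
        have h5 : (lift f z).y ^ 2 = f.eval z := (lift f z).y_sq
        rw [← h5, norm_pow, Real.sqrt_sq (norm_nonneg _)]
      have h4 : Tendsto (fun z => (lift f z).y * ((F (lift f z) - F (lift f z).conj) / 2))
          (𝓝[≠] a) (𝓝 0) := by
        refine h2.zero_mul_isBoundedUnder_le ⟨C, ?_⟩
        rw [eventually_map]
        filter_upwards [hC] with z ⟨h1, h2⟩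
        simp only [Function.comp_apply, norm_div, Complex.norm_ofNat]
        linarith [norm_sub_le (F (lift f z)) (F (lift f z).conj)]
      have h5 := h1.mul h4
      rw [mul_zero] at h5
      refine h5.congr' ?_
      filter_upwards [hne a] with z hz
      have hy : (lift f z).y ≠ 0 := (y_ne_zero_iff _).2 hz
      have hy2 : (lift f z).y ^ 2 = f.eval z := (lift f z).y_sq
      rw [oddPart, ← hy2]
      field_simp
    · exact ⟨_, Complex.analyticAt_iff_eventually_differentiableAt.2 ((hdiff' a ha).mono fun z hz => hz.2),
        EventuallyEq.rfl⟩
  refine ⟨limExtend (evenPart F), limExtend (oddPart F), fun a => ?_, fun a => ?_, fun P hy => ?_⟩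
  · obtain ⟨g, hg, hg'⟩ := hA a
    exact (hg.congr (limExtend_eventuallyEq hg hg').symm).differentiableAt
  · obtain ⟨g, hg, hg'⟩ := hB a
    exact (hg.congr (limExtend_eventuallyEq hg hg').symm).differentiableAt
  · have h := differentiableAt_parts hF ((y_ne_zero_iff _).1 hy)
    rw [limExtend_eq h.1.continuousAt, limExtend_eq h.2.continuousAt, evenPart_eq, oddPart_eq]
    exact ⟨rfl, rfl⟩

end AffineCurve

/-! ### Boundedness of the regular part at all points of a patch -/

namespace VirasoroOnePoint

open HyperellipticEquation AffineCurve

variable {H : HyperellipticEquation} {c Z : ℂ} (T : VirasoroOnePoint H.Surface c Z) {π : Patch H}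

theorem tendsto_x (P : AffineCurve π.f) :
    Tendsto (x : AffineCurve π.f → ℂ) (comap coords (𝓝 P.coords)) (𝓝 P.x) :=
  (continuous_fst.tendsto P.coords).comp tendsto_comap

theorem tendsto_y (P : AffineCurve π.f) :
    Tendsto (y : AffineCurve π.f → ℂ) (comap coords (𝓝 P.coords)) (𝓝 P.y) :=
  (continuous_snd.tendsto P.coords).comp tendsto_comap

theorem exists_tendsto_xValue {P : AffineCurve π.f} (hy : P.y ≠ 0) :
    ∃ L, Tendsto (fun Q => T.xValue π (π.ι Q)) (comap coords (𝓝 P.coords)) (𝓝 L) := by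
  set φ := π.chart (xChart π.f P.y hy) (Patch.xChart_mem _ _ _) with hφ
  have hs : π.ι P ∈ φ.source := Patch.mem_xChart_source hy
  have h0 : φ (π.ι P) = P.x := Patch.chart_apply P
  have hx : P.x ∈ φ.target := h0 ▸ φ.map_source hs
  have h1 : ContinuousAt (T.T φ) P.x :=
    ((T.holomorphic φ Patch.chart_mem_maximalAtlas).differentiableAt
      (φ.open_target.mem_nhds hx)).continuousAt
  refine ⟨_, (h1.tendsto.comp (tendsto_x P)).congr' ?_⟩
  have h2 : Tendsto (fun Q : AffineCurve π.f => (Q.y / P.y).re) (comap coords (𝓝 P.coords))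
      (𝓝 (P.y / P.y).re) :=
    (Complex.continuous_re.tendsto _).comp ((tendsto_y P).div_const _)
  rw [div_self hy, Complex.one_re] at h2
  filter_upwards [h2.eventually (lt_mem_nhds one_pos)] with Q hQ
  exact (T.xValue_eq_of_re_pos hQ).symm

theorem exists_tendsto_residue (P : AffineCurve π.f) :
    ∃ L, Tendsto (π.residue (c * Z) (T.xValue π))
      (comap coords (𝓝 P.coords) ⊓ 𝓟 {Q | Q.y ≠ 0}) (𝓝 L) := by
  have hpoly : ∀ f : ℂ[X], Tendsto (fun Q : AffineCurve π.f => f.eval Q.x)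
      (comap coords (𝓝 P.coords)) (𝓝 (f.eval P.x)) :=
    fun f => (f.continuous.tendsto _).comp (tendsto_x P)
  by_cases hy : P.y = 0
  · set φ := chartAt ℂ (π.ι P)
    have hφ : φ ∈ IsManifold.maximalAtlas 𝓘(ℂ) ω H.Surface :=
      IsManifold.chart_mem_maximalAtlas _
    have hs : π.ι P ∈ φ.source := mem_chart_source ℂ _
    obtain ⟨-, hYa⟩ := Patch.analyticAt_coords hφ hs
    have hY := Patch.deriv_Y_ne_zero hφ hs hy
    have hf : π.f.derivative.eval P.x ≠ 0 := π.regular _ (by rw [← P.y_sq, hy]; simp)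
    have ht : Tendsto (fun Q => φ (π.ι Q)) (comap coords (𝓝 P.coords)) (𝓝 (φ (π.ι P))) :=
      (φ.continuousAt hs).tendsto.comp (Patch.tendsto_ι P)
    have hTc : ContinuousAt (T.T φ) (φ (π.ι P)) :=
      ((T.holomorphic φ hφ).differentiableAt
        (φ.open_target.mem_nhds (φ.map_source hs))).continuousAt
    have hSY := (analyticAt_schwarzian hYa hY).continuousAt
    have hSf : ContinuousAt (schwarzian (fun z => π.f.eval z)) P.x :=
      (analyticAt_schwarzian (π.f.differentiable.analyticAt _)
        (by rw [Patch.deriv_eval]; exact hf)).continuousAt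
    -- This is `pullback_eq_of_deriv_Y_ne_zero` solved for `residue`. All ingredients, including `T`
    -- in the chart `φ`, are continuous at the branch point, and `Y'` does not vanish there.
    have hlim := ((((hpoly π.f.derivative).pow 2).mul
      (((hTc.tendsto.comp ht).sub ((hSY.tendsto.comp ht).const_mul (c * Z / 12))).div
        ((hYa.deriv.continuousAt.tendsto.comp ht).pow 2) (pow_ne_zero 2 hY))).add
      (((hSf.tendsto.comp (tendsto_x P)).const_mul (c * Z / 3)).mul ((tendsto_y P).pow 2)))
    refine ⟨_, (hlim.mono_left inf_le_left).congr' ?_⟩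
    have e1 := (Patch.tendsto_ι P).eventually (φ.open_source.mem_nhds hs)
    have e2 := ht.eventually (hYa.deriv.continuousAt.eventually_ne hY)
    have e3 := (hpoly π.f.derivative).eventually_ne hf
    filter_upwards [mem_inf_of_left e1, mem_inf_of_left e2, mem_inf_of_left e3,
      mem_inf_of_right (mem_principal_self _)] with Q h1 h2 h3 h4
    have h5 := Patch.pullback_eq_of_deriv_Y_ne_zero (c * Z) (T.xValue π) hφ h1 h4 h2 h3
    rw [← T.eq_pullback h4 hφ h1] at h5
    simp only [Function.comp_apply, Pi.div_apply]
    rw [h5]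
    field_simp
    ring
  · obtain ⟨L, hL⟩ := T.exists_tendsto_xValue hy
    have hf : π.f.eval P.x ≠ 0 := Patch.eval_ne_zero hy
    exact ⟨_, ((((hpoly π.f).mul hL).sub ((((hpoly π.f.derivative).pow 2).div (hpoly π.f)
      hf).const_mul (c * Z / 32))).const_mul 4).mono_left inf_le_left⟩

theorem exists_bound_residue (π : Patch H) (a : ℂ) :
    ∃ C, ∀ᶠ Q in comap (x : AffineCurve π.f → ℂ) (𝓝 a),
      Q.y ≠ 0 → ‖π.residue (c * Z) (T.xValue π) Q‖ ≤ C := by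
  set P := lift π.f a
  have h : P.y ^ 2 = π.f.eval a := csqrt_sq _
  have key : ∀ P : AffineCurve π.f, ∃ C, ∀ᶠ Q in comap coords (𝓝 P.coords),
      Q.y ≠ 0 → ‖π.residue (c * Z) (T.xValue π) Q‖ ≤ C := by
    intro P
    obtain ⟨L, hL⟩ := T.exists_tendsto_residue P
    refine ⟨‖L‖ + 1, ?_⟩
    exact eventually_inf_principal.1
      ((hL.norm.eventually (gt_mem_nhds (lt_add_one ‖L‖))).mono fun Q hQ => hQ.le)
  obtain ⟨C₁, h₁⟩ := key P
  obtain ⟨C₂, h₂⟩ := key P.conj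
  refine ⟨max C₁ C₂, comap_x_le a P.y h ?_⟩
  exact ⟨h₁.mono fun Q hQ hy => (hQ hy).trans (le_max_left _ _),
    h₂.mono fun Q hQ hy => (hQ hy).trans (le_max_right _ _)⟩

theorem differentiableOn_residue (π : Patch H) (b : ℂ) (hb : b ≠ 0) :
    DifferentiableOn ℂ (fun x => π.residue (c * Z) (T.xValue π) ((xChart π.f b hb).symm x))
      (xChart π.f b hb).target := by
  set φ := π.chart (xChart π.f b hb) (Patch.xChart_mem _ _ _)
  have hT : DifferentiableOn ℂ (T.T φ) (xChart π.f b hb).target :=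
    T.holomorphic φ Patch.chart_mem_maximalAtlas
  have hne : ∀ x ∈ (xChart π.f b hb).target, π.f.eval x ≠ 0 := by
    intro x hx h0
    have hx' : π.f.eval x / b ^ 2 ∈ Complex.slitPlane := hx
    rw [h0, zero_div] at hx'
    exact Complex.slitPlane_ne_zero hx' rfl
  have h := ((π.f.differentiable.differentiableOn.mul hT).sub
    (((π.f.derivative.differentiable.differentiableOn.pow 2).div
      π.f.differentiable.differentiableOn hne).const_mul (c * Z / 32))).const_mul 4
  refine h.congr fun x hx => ?_
  have h1 := T.xValue_eq_of_re_pos (π := π) (P := (xChart π.f b hb).symm x) (hb := hb)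
    ((xChart π.f b hb).map_target hx)
  simp only [Patch.residue, h1]
  rfl

end VirasoroOnePoint

/-! ### The condition at infinity on the Galois-even part -/

namespace HyperellipticEquation

open AffineCurve

variable (H : HyperellipticEquation)

/-- The polynomial that describes the difference of the polar parts at infinity of a projective
connection in the two patches. -/
def twist (κ : ℂ) : ℂ[X] :=
  C (κ / 8) * (C ((2 * H.g + 2 : ℂ) ^ 2) * H.p - C (2 * (2 * H.g + 2 : ℂ)) * (X * derivative H.p))

theorem coeff_natDegree_ne_zero : H.p.coeff H.p.natDegree ≠ 0 := by
  rw [coeff_natDegree, leadingCoeff_ne_zero]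
  rintro h
  have := H.natDegree_p
  simp [h] at this

theorem eventually_eval_p_ne_zero : ∀ᶠ x in cocompact ℂ, H.p.eval x ≠ 0 := by
  filter_upwards [(tendsto_eval_div_pow le_rfl).eventually_ne H.coeff_natDegree_ne_zero]
    with x hx h
  exact hx (by rw [h, zero_div])

theorem eval_twist (κ x : ℂ) : (H.twist κ).eval x =
    κ / 8 * ((2 * H.g + 2) ^ 2 * H.p.eval x -
      2 * (2 * H.g + 2) * x * H.p.derivative.eval x) := by
  simp only [twist, eval_mul, eval_C, eval_sub, eval_X]
  ring

theorem coeff_twist (κ : ℂ) (k : ℕ) : (H.twist κ).coeff (k + 2) =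
    κ / 8 * ((2 * H.g + 2) ^ 2 - 2 * (2 * H.g + 2) * (k + 2)) * H.p.coeff (k + 2) := by
  simp only [twist, coeff_C_mul, coeff_sub, coeff_X_mul, coeff_derivative]
  push_cast
  ring

theorem natDegree_twist_le (κ : ℂ) : (H.twist κ).natDegree ≤ 2 * H.g + 2 := by
  rw [natDegree_le_iff_coeff_eq_zero]
  intro k hk
  obtain ⟨j, rfl⟩ : ∃ j, k = j + 2 := ⟨k - 2, by omega⟩
  rw [coeff_twist, coeff_eq_zero_of_natDegree_lt (lt_of_le_of_lt H.natDegree_le hk), mul_zero]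

/-- The condition at infinity for the Galois-even part of a one-point function. -/
def IsAdmissible (κ : ℂ) (A : ℂ[X]) : Prop := (X ^ 2 * A - H.twist κ).natDegree ≤ 2 * H.g

variable {H}

/-- Admissibility prescribes exactly the coefficients of degree at least `2 g - 1`. The admissible
polynomials are therefore a torsor under `degreeLT ℂ (2 * H.g - 1)`, as the next two lemmas say. -/
theorem IsAdmissible.coeff_eq {κ : ℂ} {A : ℂ[X]} (hA : H.IsAdmissible κ A) {k : ℕ}
    (hk : 2 * H.g < k + 2) : A.coeff k =
      κ / 8 * ((2 * H.g + 2) ^ 2 - 2 * (2 * H.g + 2) * (k + 2)) * H.p.coeff (k + 2) := by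
  have h := coeff_eq_zero_of_natDegree_lt (lt_of_le_of_lt hA hk)
  rw [coeff_sub, coeff_twist, mul_comm (X ^ 2), coeff_mul_X_pow] at h
  exact sub_eq_zero.1 h

theorem IsAdmissible.add {κ : ℂ} {A A₀ : ℂ[X]} (hA : H.IsAdmissible κ A)
    (hA₀ : A₀ ∈ degreeLT ℂ (2 * H.g - 1)) : H.IsAdmissible κ (A + A₀) := by
  have h : (X ^ 2 * A₀).natDegree ≤ 2 * H.g := by
    rw [natDegree_le_iff_coeff_eq_zero]
    intro k hk
    obtain ⟨j, rfl⟩ : ∃ j, k = j + 2 := ⟨k - 2, by have := H.one_le_g; omega⟩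
    rw [mul_comm, coeff_mul_X_pow]
    refine coeff_eq_zero_of_degree_lt ((mem_degreeLT.1 hA₀).trans_le ?_)
    exact_mod_cast (by omega : 2 * H.g - 1 ≤ j)
  rw [IsAdmissible, mul_add, add_sub_right_comm]
  exact (natDegree_add_le _ _).trans (max_le hA h)

theorem IsAdmissible.sub_mem {κ : ℂ} {A A₀ : ℂ[X]} (hA : H.IsAdmissible κ A)
    (hA₀ : H.IsAdmissible κ A₀) : A - A₀ ∈ degreeLT ℂ (2 * H.g - 1) := by
  rw [mem_degreeLT, degree_lt_iff_coeff_zero]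
  intro k hk
  rw [coeff_sub, hA.coeff_eq (by omega), hA₀.coeff_eq (by omega), sub_self]

variable (H) in
theorem exists_isAdmissible (κ : ℂ) : ∃ A, H.IsAdmissible κ A := by
  have hg := H.one_le_g
  -- Only the two top coefficients of `twist` have to be cancelled.
  refine ⟨C ((H.twist κ).coeff (2 * H.g + 2)) * X ^ (2 * H.g) +
    C ((H.twist κ).coeff (2 * H.g + 1)) * X ^ (2 * H.g - 1), ?_⟩
  rw [IsAdmissible, natDegree_le_iff_coeff_eq_zero]
  intro k hk
  obtain ⟨j, rfl⟩ : ∃ j, k = j + 2 := ⟨k - 2, by omega⟩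
  rw [coeff_sub, mul_comm (X ^ 2), coeff_mul_X_pow, coeff_add, coeff_C_mul_X_pow,
    coeff_C_mul_X_pow]
  by_cases h1 : j = 2 * H.g
  · rw [if_pos h1, if_neg (by omega), h1]
    simp
  · by_cases h2 : j = 2 * H.g - 1
    · rw [if_neg h1, if_pos h2, show j + 2 = 2 * H.g + 1 by omega]
      simp
    · rw [if_neg h1, if_neg h2, coeff_eq_zero_of_natDegree_lt
        (lt_of_le_of_lt (H.natDegree_twist_le κ) (by omega))]
      simp

/-- The projective connection with prescribed polar part and regular part `A x + y B x` in the
coordinate `x` of a patch. -/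
def Patch.ofParts (π : Patch H) (κ : ℂ) (A B : ℂ[X]) (s : H.Surface) : ℂ :=
  (κ / 32 * (π.f.derivative.eval (π.X s) ^ 2 / π.f.eval (π.X s)) +
    1 / 4 * (A.eval (π.X s) + π.Y s * B.eval (π.X s))) / π.f.eval (π.X s)

theorem Patch.residue_ofParts {π : Patch H} (κ : ℂ) (A B : ℂ[X]) {P : AffineCurve π.f}
    (hy : P.y ≠ 0) : π.residue κ (π.ofParts κ A B) P = A.eval P.x + P.y * B.eval P.x := by
  have := Patch.eval_ne_zero hy
  rw [Patch.residue, Patch.ofParts, Patch.X_ι, Patch.Y_ι]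
  field_simp
  ring

theorem Patch.eq_of_residue_eq {π : Patch H} {κ : ℂ} {θ θ' : H.Surface → ℂ} {P : AffineCurve π.f}
    (hy : P.y ≠ 0) (h : π.residue κ θ P = π.residue κ θ' P) : θ (π.ι P) = θ' (π.ι P) := by
  have hf := Patch.eval_ne_zero hy
  simp only [Patch.residue] at h
  refine mul_left_cancel₀ hf ?_
  linear_combination h / 4

end HyperellipticEquation

/-! ### Correspondence between one-point functions and pairs of polynomials -/

namespace VirasoroOnePoint

open HyperellipticEquation AffineCurve

variable {H : HyperellipticEquation} {c Z : ℂ}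

theorem hasGaloisSplitting_iff {T : VirasoroOnePoint H.Surface c Z} {A B : ℂ[X]} :
    T.HasGaloisSplitting A B ↔ ∀ P : AffineCurve H.p, P.y ≠ 0 →
      (finitePatch H).residue (c * Z) (T.xValue (finitePatch H)) P =
        A.eval P.x + P.y * B.eval P.x := by
  have key : ∀ P : H.XDomain, (H.p.eval P.x * T.atX P =
      c / 32 * (H.p.derivative.eval P.x ^ 2 / H.p.eval P.x) * Z +
        1 / 4 * (A.eval P.x + P.y * B.eval P.x)) ↔
      (finitePatch H).residue (c * Z) (T.xValue (finitePatch H)) P.1 =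
        A.eval P.1.x + P.1.y * B.eval P.1.x := by
    intro P
    rw [T.atX_eq]
    change _ ↔ 4 * (H.p.eval P.x * T.xValue (finitePatch H) (Surface.finite P.1) -
      c * Z / 32 * (H.p.derivative.eval P.x ^ 2 / H.p.eval P.x)) = A.eval P.x + P.y * B.eval P.x
    constructor <;> intro h
    · rw [h]
      ring
    · linear_combination h / 4
  constructor
  · intro h P hy
    exact (key ⟨P, hy⟩).1 (h ⟨P, hy⟩)
  · intro h P
    exact (key P).2 (h P.1 P.2)

/-- Every pair of polynomials that satisfies the condition at infinity comes from a one-point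
function. -/
theorem exists_of_isAdmissible {A B : ℂ[X]} (hA : H.IsAdmissible (c * Z) A)
    (hB : B ∈ degreeLT ℂ (H.g - 2)) :
    ∃ T : VirasoroOnePoint H.Surface c Z, T.HasGaloisSplitting A B := by
  set θ := (finitePatch H).ofParts (c * Z) A B with hθ
  -- Since `y = w x ^ (g + 1)`, the regular part in the patch at infinity is `u ^ (2 g) (x ^ 2 A -
  -- twist) + w u ^ (g - 3) B`; the hypotheses make both coefficients polynomials in `u`.
  set A' := (X ^ 2 * A - H.twist (c * Z)).reflect (2 * H.g)
  set B' := B.reflect (H.g - 3)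
  set θ' := (infinityPatch H).ofParts (c * Z) A' B' with hθ'
  have h1 : ∀ P : AffineCurve H.p, P.y ≠ 0 →
      (finitePatch H).residue (c * Z) θ P = A.eval P.x + P.y * B.eval P.x :=
    fun P hy => Patch.residue_ofParts _ _ _ hy
  have h2 : ∀ P : AffineCurve H.q, P.y ≠ 0 →
      (infinityPatch H).residue (c * Z) θ' P = A'.eval P.x + P.y * B'.eval P.x :=
    fun P hy => Patch.residue_ofParts _ _ _ hy
  -- Multiplying by `u ^ 2` avoids the truncated exponent `g - 3`: for `g ≤ 2` the hypothesis forces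
  -- `B = 0` and both sides vanish.
  have hB' : ∀ u : ℂ, u ≠ 0 → u ^ 2 * B'.eval u = u ^ (H.g - 1) * B.eval u⁻¹ := by
    intro u hu
    by_cases hB0 : B = 0
    · have : B' = 0 := by simp [B', hB0]
      simp [this, hB0]
    · have hd := mem_degreeLT.1 hB
      rw [degree_eq_natDegree hB0] at hd
      have hd' : B.natDegree < H.g - 2 := by exact_mod_cast hd
      rw [eval_reflect (by omega) hu, ← mul_assoc, ← pow_add]
      congr 2
      omega
  obtain ⟨T, hT⟩ := exists_virasoroOnePoint (c := c) (Z := Z) h1 h2 (by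
    intro P hx hy
    obtain ⟨Q, hQ⟩ := Surface.exists_ofInfinity P hx
    obtain ⟨-, hQx, hQy⟩ := X_finite_eq hQ
    have hQy0 : Q.y ≠ 0 := by
      rw [hQy]
      exact div_ne_zero hy (pow_ne_zero _ hx)
    have hQ0 : Q.x ≠ 0 := by rw [hQx]; exact inv_ne_zero hx
    have h3 := residue_infinityPatch (c * Z) (θ := θ)
      (θ' := fun s => (finitePatch H).X s ^ 4 * θ s) hQ hy (by simp only [X_finite])
    rw [h1 P hy, ← eval_twist] at h3
    have h4 : (infinityPatch H).residue (c * Z) θ' Q =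
        (infinityPatch H).residue (c * Z) (fun s => (finitePatch H).X s ^ 4 * θ s) Q := by
      refine mul_left_cancel₀ (pow_ne_zero (2 * H.g) hx) ?_
      rw [h3, h2 Q hQy0, eval_reflect hA hQ0, hQy]
      have h5 := hB' Q.x hQ0
      have h6 : Q.x⁻¹ = P.x := by rw [hQx, inv_inv]
      rw [h6, hQx] at h5
      rw [h6, hQx]
      simp only [eval_sub, eval_mul, eval_pow, eval_X]
      obtain ⟨g, hg⟩ : ∃ g, H.g = g + 1 := ⟨H.g - 1, by have := H.one_le_g; omega⟩
      rw [hg, Nat.add_sub_cancel] at h5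
      rw [hg]
      have h7 : B'.eval P.x⁻¹ = P.x ^ 2 * (P.x⁻¹ ^ g * B.eval P.x) := by
        rw [← h5]
        field_simp
      rw [h7]
      simp only [inv_pow, mul_add, pow_add, pow_mul]
      field_simp
      ring
    have h5 := Patch.eq_of_residue_eq (π := infinityPatch H) hQy0 h4
    change θ' (Surface.ofInfinity H Q) = (finitePatch H).X (Surface.ofInfinity H Q) ^ 4 *
      θ (Surface.ofInfinity H Q) at h5
    rwa [← hQ, X_finite] at h5)
  refine ⟨T, hasGaloisSplitting_iff.2 fun P hy => ?_⟩
  rw [← h1 P hy]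
  have h3 : T.xValue (finitePatch H) (Surface.finite P) = θ (Surface.finite P) :=
    (T.atX_eq ⟨P, hy⟩).symm.trans (hT ⟨P, hy⟩)
  have h4 : T.xValue (finitePatch H) ((finitePatch H).ι P) = θ ((finitePatch H).ι P) := h3
  simp only [Patch.residue, h4]

variable (T : VirasoroOnePoint H.Surface c Z)

/-- The regular part in the patch at infinity is bounded near `u = 0`; `residue_infinityPatch` turns
this into growth in `x`, on both sheets at once. -/
theorem exists_bound_infinity : ∃ C : ℝ, ∀ᶠ x in cocompact ℂ, ∀ P : AffineCurve H.p, P.x = x →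
    P.y ≠ 0 ∧ ‖x ^ 2 * (finitePatch H).residue (c * Z) (T.xValue (finitePatch H)) P -
      (H.twist (c * Z)).eval x‖ ≤ C * ‖x‖ ^ (2 * H.g) := by
  obtain ⟨C, U, hU, hUC⟩ := T.exists_bound_residue (infinityPatch H) 0
  refine ⟨C, ?_⟩
  filter_upwards [eventually_ne_zero_cocompact, H.eventually_eval_p_ne_zero,
    tendsto_inv_cocompact.eventually hU]
    with x hx hpx hxU P hP
  subst hP
  have hy : P.y ≠ 0 := (y_ne_zero_iff P).2 hpx
  refine ⟨hy, ?_⟩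
  obtain ⟨Q, hQ⟩ := Surface.exists_ofInfinity P hx
  obtain ⟨-, hQx, hQy⟩ := X_finite_eq hQ
  have hQy0 : Q.y ≠ 0 := by
    rw [hQy]
    exact div_ne_zero hy (pow_ne_zero _ hx)
  have h1 := hUC (show Q.x ∈ U by rw [hQx]; exact hxU) hQy0
  rw [eval_twist, ← residue_infinityPatch (c * Z) hQ hy (T.xValue_infinityPatch hx hy), norm_mul,
    norm_pow, mul_comm]
  exact mul_le_mul_of_nonneg_right h1 (by positivity)

theorem isBigO_pow_eval_p :
    (fun x : ℂ => x ^ (2 * H.g + 1)) =O[cocompact ℂ] fun x => H.p.eval x := by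
  refine IsBigO.trans ?_ (isBigO_pow_eval le_rfl H.coeff_natDegree_ne_zero)
  refine IsBigO.of_bound 1 ?_
  filter_upwards [(tendsto_norm_cocompact_atTop (E := ℂ)).eventually_ge_atTop 1] with x hx
  rw [one_mul, norm_pow, norm_pow]
  exact pow_le_pow_right₀ hx (by rcases H.natDegree_p with h | h <;> omega)

/-- The sum and difference of the bounds on the two sheets give `x ^ 2 A - twist = O(x ^ (2 g))` and
`x ^ 2 y B = O(x ^ (2 g))`. As `|y| ^ 2 = |p|` grows at least like `|x| ^ (2 g + 1)`, `B` is `O(|x|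
^ (g - 5/2))`, half a power below the growth that is needed. -/
theorem exists_splitting : ∃ A B : ℂ[X], T.HasGaloisSplitting A B ∧
    H.IsAdmissible (c * Z) A ∧ B ∈ degreeLT ℂ (H.g - 2) := by
  obtain ⟨A, B, hA, hB, hAB⟩ := exists_entire H.p_regular
    (T.differentiableOn_residue (finitePatch H))
    (fun a _ => T.exists_bound_residue (finitePatch H) a)
  obtain ⟨C, hC⟩ := T.exists_bound_infinity
  have hC0 : ∀ᶠ x in cocompact ℂ, ‖x ^ 2 * A x - (H.twist (c * Z)).eval x‖ ≤ C * ‖x‖ ^ (2 * H.g) ∧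
      ‖x‖ ^ 4 * (‖H.p.eval x‖ * ‖B x‖ ^ 2) ≤ (C * ‖x‖ ^ (2 * H.g)) ^ 2 := by
    filter_upwards [hC] with x hx
    obtain ⟨hy, h1⟩ := hx (lift H.p x) rfl
    obtain ⟨-, h2⟩ := hx (lift H.p x).conj rfl
    obtain ⟨h3, h4⟩ := hAB (lift H.p x) hy
    change A x = _ at h3
    change B x = _ at h4
    set R := (finitePatch H).residue (c * Z) (T.xValue (finitePatch H))
    constructor
    · rw [h3, show x ^ 2 * ((R (lift H.p x) + R (lift H.p x).conj) / 2) -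
        (H.twist (c * Z)).eval x = ((x ^ 2 * R (lift H.p x) - (H.twist (c * Z)).eval x) +
          (x ^ 2 * R (lift H.p x).conj - (H.twist (c * Z)).eval x)) / 2 by ring, norm_div,
        Complex.norm_ofNat]
      linarith [norm_add_le (x ^ 2 * R (lift H.p x) - (H.twist (c * Z)).eval x)
        (x ^ 2 * R (lift H.p x).conj - (H.twist (c * Z)).eval x)]
    · have hy2 : (lift H.p x).y ^ 2 = H.p.eval x := (lift H.p x).y_sq
      have h5 : x ^ 2 * ((lift H.p x).y * B x) =
          ((x ^ 2 * R (lift H.p x) - (H.twist (c * Z)).eval x) -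
          (x ^ 2 * R (lift H.p x).conj - (H.twist (c * Z)).eval x)) / 2 := by
        rw [h4]
        field_simp
        ring
      have h6 : ‖x ^ 2 * ((lift H.p x).y * B x)‖ ≤ C * ‖x‖ ^ (2 * H.g) := by
        rw [h5, norm_div, Complex.norm_ofNat]
        linarith [norm_sub_le (x ^ 2 * R (lift H.p x) - (H.twist (c * Z)).eval x)
          (x ^ 2 * R (lift H.p x).conj - (H.twist (c * Z)).eval x)]
      calc ‖x‖ ^ 4 * (‖H.p.eval x‖ * ‖B x‖ ^ 2) = ‖x ^ 2 * ((lift H.p x).y * B x)‖ ^ 2 := by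
            rw [← hy2]
            simp only [norm_mul, norm_pow]
            ring
        _ ≤ _ := pow_le_pow_left₀ (norm_nonneg _) h6 2
  have hge : ∀ᶠ x : ℂ in cocompact ℂ, 1 ≤ ‖x‖ :=
    (tendsto_norm_cocompact_atTop (E := ℂ)).eventually_ge_atTop 1
  have hE : (fun x => x ^ 2 * A x - (H.twist (c * Z)).eval x) =O[cocompact ℂ]
      fun x => x ^ (2 * H.g) := by
    refine IsBigO.of_bound C (hC0.mono fun x hx => ?_)
    rw [norm_pow]
    exact hx.1
  have hlt : ∀ m : ℕ, (fun x : ℂ => x ^ m) =o[cocompact ℂ] fun x => x ^ (m + 1) := by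
    intro m
    refine (isLittleO_iff_tendsto' ?_).2 (tendsto_inv_cocompact.congr' ?_)
    · filter_upwards [eventually_ne_zero_cocompact] with x hx h
      exact absurd h (pow_ne_zero _ hx)
    · filter_upwards [eventually_ne_zero_cocompact] with x hx
      field_simp
      ring
  have hA' : A =o[cocompact ℂ] fun x => x ^ (2 * H.g + 1) := by
    have h1 : (fun x => x ^ 2 * A x) =O[cocompact ℂ] fun x => x ^ (2 * H.g + 2) := by
      have h2 : (fun x : ℂ => x ^ (2 * H.g)) =O[cocompact ℂ] fun x => x ^ (2 * H.g + 2) :=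
        ((hlt _).trans (hlt _)).isBigO
      refine ((hE.trans h2).add (isBigO_eval (H.natDegree_twist_le (c * Z)))).congr_left fun x => ?_
      ring
    have h3 := (isBigO_refl (fun x : ℂ => (x ^ 2)⁻¹) (cocompact ℂ)).mul h1
    refine (h3.congr' ?_ ?_).trans_isLittleO (hlt (2 * H.g))
    · filter_upwards [eventually_ne_zero_cocompact] with x hx
      field_simp
    · filter_upwards [eventually_ne_zero_cocompact] with x hx
      rw [pow_add]
      field_simp
  have hB' : B =o[cocompact ℂ] fun x => x ^ (H.g - 2) := by
    obtain ⟨K, hK0, hK⟩ := (isBigO_pow_eval_p (H := H)).exists_pos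
    rw [isLittleO_iff]
    intro ε hε
    set D := K * C ^ 2
    filter_upwards [hC0, hge, hK.bound,
      (tendsto_norm_cocompact_atTop (E := ℂ)).eventually_ge_atTop (D / ε ^ 2)] with x h1 h2 h3 h4
    have h5 := h1.2
    rw [norm_pow] at h3
    rw [norm_pow]
    set r := ‖x‖
    have hr : 0 < r := by linarith
    have h6 : r ^ (2 * H.g + 5) * ‖B x‖ ^ 2 ≤ D * r ^ (4 * H.g) := by
      calc r ^ (2 * H.g + 5) * ‖B x‖ ^ 2 = r ^ 4 * (r ^ (2 * H.g + 1) * ‖B x‖ ^ 2) := by ring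
        _ ≤ r ^ 4 * ((K * ‖H.p.eval x‖) * ‖B x‖ ^ 2) := by gcongr
        _ = K * (r ^ 4 * (‖H.p.eval x‖ * ‖B x‖ ^ 2)) := by ring
        _ ≤ K * (C * r ^ (2 * H.g)) ^ 2 := by gcongr
        _ = D * r ^ (4 * H.g) := by
          simp only [D]
          ring
    -- The exponents satisfy `4 g + 1 ≤ 2 g + 5 + 2 (g - 2)`, with equality for `g ≥ 2`; truncation
    -- makes the inequality strict for `g = 1`, which is harmless because `r ≥ 1`. The spare factor
    -- `r` on the left produces the little-o.
    have h7 : r ^ (4 * H.g) * (r * ‖B x‖ ^ 2) ≤ r ^ (4 * H.g) * (D * (r ^ (H.g - 2)) ^ 2) := by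
      calc r ^ (4 * H.g) * (r * ‖B x‖ ^ 2) = r ^ (4 * H.g + 1) * ‖B x‖ ^ 2 := by ring
        _ ≤ r ^ (2 * H.g + 5 + (H.g - 2) * 2) * ‖B x‖ ^ 2 :=
          mul_le_mul_of_nonneg_right (pow_le_pow_right₀ h2 (by omega)) (sq_nonneg _)
        _ = (r ^ (2 * H.g + 5) * ‖B x‖ ^ 2) * (r ^ (H.g - 2)) ^ 2 := by
          rw [pow_add, pow_mul]
          ring
        _ ≤ (D * r ^ (4 * H.g)) * (r ^ (H.g - 2)) ^ 2 := by gcongr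
        _ = _ := by ring
    have h8 : r * ‖B x‖ ^ 2 ≤ D * (r ^ (H.g - 2)) ^ 2 := le_of_mul_le_mul_left h7 (by positivity)
    have h9 : D ≤ r * ε ^ 2 := (div_le_iff₀ (by positivity)).1 h4
    have h10 : r * ‖B x‖ ^ 2 ≤ r * (ε * r ^ (H.g - 2)) ^ 2 := by
      refine h8.trans ((mul_le_mul_of_nonneg_right h9 (by positivity)).trans_eq ?_)
      ring
    exact le_of_sq_le_sq (le_of_mul_le_mul_left h10 hr) (by positivity)
  obtain ⟨A₁, hA₁, hA₂⟩ := exists_polynomial_of_isLittleO _ hA hA'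
  obtain ⟨B₁, hB₁, hB₂⟩ := exists_polynomial_of_isLittleO _ hB hB'
  refine ⟨A₁, B₁, hasGaloisSplitting_iff.2 fun P hy => ?_, ?_, hB₁⟩
  · obtain ⟨h3, h4⟩ := hAB P hy
    rw [← hA₂, ← hB₂, h3, h4]
    field_simp
    ring
  · obtain ⟨E, hE₁, hE₂⟩ := exists_polynomial_of_isLittleO (2 * H.g + 1)
      (F := fun x => (X ^ 2 * A₁ - H.twist (c * Z)).eval x) (Polynomial.differentiable _) (by
        refine (hE.congr_left fun x => ?_).trans_isLittleO (hlt _)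
        simp [hA₂])
    have hEq : X ^ 2 * A₁ - H.twist (c * Z) = E := Polynomial.funext hE₂
    rw [IsAdmissible, hEq, natDegree_le_iff_coeff_eq_zero]
    intro k hk
    exact (degree_lt_iff_coeff_zero _ _).1 (mem_degreeLT.1 hE₁) k hk

end VirasoroOnePoint

/-! ### Behaviour of the one-point function at infinity -/

theorem ContinuousAt.exists_eventually_lt {f : ℂ → ℝ} {a : ℂ} (hf : ContinuousAt f a) :
    ∃ M, ∀ᶠ u in 𝓝 a, f u < M :=
  ⟨f a + 1, hf.eventually (gt_mem_nhds (lt_add_one _))⟩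

namespace HyperellipticEquation

variable {H : HyperellipticEquation}

theorem eventually_xToInfinity {p : AffineCurve H.q → Prop}
    (h : ∀ᶠ Q in comap (AffineCurve.x : AffineCurve H.q → ℂ) (𝓝 0), p Q) :
    ∀ᶠ P : H.XDomain in H.xToInfinity,
      ∃ Q, Surface.finite P.1 = Surface.ofInfinity H Q ∧ P.x ≠ 0 ∧ Q.x = P.x⁻¹ ∧ Q.y ≠ 0 ∧ p Q := by
  obtain ⟨U, hU, hUp⟩ := h
  have h1 : ∀ᶠ P : H.XDomain in H.xToInfinity, P.x ≠ 0 ∧ P.x⁻¹ ∈ U :=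
    tendsto_comap.eventually (eventually_ne_zero_cocompact.and (tendsto_inv_cocompact.eventually hU))
  filter_upwards [h1] with P ⟨hx, hPU⟩
  obtain ⟨Q, hQ⟩ := Surface.exists_ofInfinity P.1 hx
  obtain ⟨-, hQx, hQy⟩ := X_finite_eq hQ
  refine ⟨Q, hQ, hx, hQx, ?_, hUp (show Q.x ∈ U by rw [hQx]; exact hPU)⟩
  rw [hQy]
  exact div_ne_zero P.2 (pow_ne_zero _ hx)

/-- `u` is continuous near a point at infinity, vanishes there, and equals `1 / x` at nearby finite
points. A limit over all sheets thus yields the limit at each point over infinity. -/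
theorem comap_nhds_infinite_le (w : ℂ) (hw : w ^ 2 = H.p.coeff (2 * H.g + 2)) :
    comap (fun P : H.XDomain => Surface.finite P.1) (𝓝 (Surface.infinite w hw)) ≤
      H.xToInfinity := by
  obtain ⟨Q₀, hQ₀, hx₀, -⟩ := exists_infinite_eq w hw
  have h1 : Tendsto (fun P : H.XDomain => (infinityPatch H).X (Surface.finite P.1))
      (comap (fun P : H.XDomain => Surface.finite P.1) (𝓝 (Surface.infinite w hw))) (𝓝 0) := by
    have h0 : Tendsto (fun P : H.XDomain => Surface.finite P.1)
        (comap (fun P : H.XDomain => Surface.finite P.1) (𝓝 (Surface.infinite w hw)))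
        (𝓝 (Surface.ofInfinity H Q₀)) := by
      rw [← hQ₀]
      exact tendsto_comap
    have h := (continuous_fst.tendsto _).comp
      ((Patch.tendsto_coords (π := infinityPatch H) Q₀).comp h0)
    change Tendsto _ _ (𝓝 Q₀.x) at h
    rwa [hx₀] at h
  have h2 : ∀ᶠ P : H.XDomain in comap (fun P : H.XDomain => Surface.finite P.1)
      (𝓝 (Surface.infinite w hw)), P.x ≠ 0 ∧ (infinityPatch H).X (Surface.finite P.1) = P.x⁻¹ := by
    have h3 : ∀ᶠ s in 𝓝 (Surface.infinite w hw), s ∈ Set.range (Surface.ofInfinity H) :=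
      (Patch.isOpen_range (π := infinityPatch H)).mem_nhds ⟨Q₀, hQ₀.symm⟩
    filter_upwards [tendsto_comap.eventually h3] with P ⟨Q, hQ⟩
    obtain ⟨hx, hQx, -⟩ := X_finite_eq hQ.symm
    refine ⟨hx, ?_⟩
    rw [← hQ, X_ofInfinity, hQx]
    rfl
  rw [xToInfinity, ← tendsto_iff_comap, ← Metric.cobounded_eq_cocompact]
  have h4 : Tendsto (fun P : H.XDomain => (infinityPatch H).X (Surface.finite P.1))
      (comap (fun P : H.XDomain => Surface.finite P.1) (𝓝 (Surface.infinite w hw))) (𝓝[≠] 0) := by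
    refine tendsto_nhdsWithin_iff.2 ⟨h1, h2.mono fun P hP => ?_⟩
    rw [hP.2]
    exact inv_ne_zero hP.1
  refine (tendsto_inv₀_nhdsNE_zero.comp h4).congr' (h2.mono fun P hP => ?_)
  simp [hP.2]

theorem natDegree_eq_of_even (h : Even H.p.natDegree) : H.p.natDegree = 2 * H.g + 2 := by
  rcases H.natDegree_p with h1 | h1
  · rw [h1] at h
    exact absurd h (by simp [parity_simps])
  · exact h1

theorem eval_q_zero_ne_zero (h : Even H.p.natDegree) : H.q.eval 0 ≠ 0 := by
  rw [H.eval_q_zero, ← natDegree_eq_of_even h]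
  exact H.coeff_natDegree_ne_zero

theorem natDegree_eq_of_odd (h : Odd H.p.natDegree) : H.p.natDegree = 2 * H.g + 1 := by
  rcases H.natDegree_p with h1 | h1
  · exact h1
  · rw [h1] at h
    exact absurd h (by simp [parity_simps])

end HyperellipticEquation

namespace VirasoroOnePoint

open HyperellipticEquation AffineCurve

variable {H : HyperellipticEquation} {c Z : ℂ} (T : VirasoroOnePoint H.Surface c Z)

theorem pow_mul_atX {P : H.XDomain} (hx : P.x ≠ 0) {Q : AffineCurve H.q}
    (hQ : Surface.finite P.1 = Surface.ofInfinity H Q) :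
    P.x ^ 4 * T.atX P = T.xValue (infinityPatch H) (Surface.ofInfinity H Q) := by
  rw [T.atX_eq, ← hQ]
  exact (T.xValue_infinityPatch hx P.2).symm

theorem eval_q_mul_xValue (Q : AffineCurve H.q) :
    H.q.eval Q.x * T.xValue (infinityPatch H) (Surface.ofInfinity H Q) =
      c * Z / 32 * (H.q.derivative.eval Q.x ^ 2 / H.q.eval Q.x) +
        (infinityPatch H).residue (c * Z) (T.xValue (infinityPatch H)) Q / 4 := by
  change _ = _ + 4 * (H.q.eval Q.x * T.xValue (infinityPatch H) (Surface.ofInfinity H Q) -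
    c * Z / 32 * (H.q.derivative.eval Q.x ^ 2 / H.q.eval Q.x)) / 4
  ring

/-- Here `q(0) ≠ 0`, so `⟨T(u)⟩ = x ^ 4 ⟨T(x)⟩` has no polar part at `u = 0` and is bounded there.
-/
theorem isBigO_atX_of_even (h : Even H.p.natDegree) :
    T.atX =O[H.xToInfinity] (fun P => (P.x ^ 4)⁻¹) := by
  obtain ⟨C, hC⟩ := T.exists_bound_residue (infinityPatch H) 0
  have hq := eval_q_zero_ne_zero h
  have hc : ContinuousAt (fun u : ℂ => ‖(H.q.eval u)⁻¹‖ *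
      (‖c * Z / 32 * (H.q.derivative.eval u ^ 2 / H.q.eval u)‖ + C / 4)) 0 := by
    have h1 : ContinuousAt (fun u => H.q.eval u) (0 : ℂ) := H.q.continuous.continuousAt
    have h2 : ContinuousAt (fun u => H.q.derivative.eval u) (0 : ℂ) :=
      H.q.derivative.continuous.continuousAt
    exact (h1.inv₀ hq).norm.mul
      (((continuousAt_const.mul ((h2.pow 2).div h1 hq)).norm).add continuousAt_const)
  obtain ⟨M, hc'⟩ := hc.exists_eventually_lt
  have hq' : ∀ᶠ u in 𝓝 (0 : ℂ), H.q.eval u ≠ 0 := H.q.continuous.continuousAt.eventually_ne hq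
  have hev := eventually_xToInfinity (hC.and (tendsto_comap.eventually (hc'.and hq')))
  refine IsBigO.of_bound M (hev.mono ?_)
  rintro P ⟨Q, hQ, hx, hQx, hQy, hR, hb, hQ0⟩
  have h1 := T.pow_mul_atX hx hQ
  have h2 := T.eval_q_mul_xValue Q
  rw [← h1] at h2
  have h3 : T.atX P = (P.x ^ 4)⁻¹ * ((H.q.eval Q.x)⁻¹ *
      (c * Z / 32 * (H.q.derivative.eval Q.x ^ 2 / H.q.eval Q.x) +
        (infinityPatch H).residue (c * Z) (T.xValue (infinityPatch H)) Q / 4)) := by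
    rw [← h2]
    field_simp
  rw [h3, norm_mul, mul_comm, norm_mul]
  refine mul_le_mul_of_nonneg_right (le_trans ?_ hb.le) (norm_nonneg _)
  refine mul_le_mul_of_nonneg_left ((norm_add_le _ _).trans (add_le_add_right ?_ _)) (norm_nonneg _)
  rw [norm_div, Complex.norm_ofNat]
  linarith [hR hQy]

theorem exists_tendsto_pow_mul_atX (h : Even H.p.natDegree) (w : ℂ)
    (hw : w ^ 2 = H.p.coeff (2 * H.g + 2)) :
    ∃ L : ℂ, Tendsto (fun P : H.XDomain => P.x ^ 4 * T.atX P)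
      (comap (fun P : H.XDomain => Surface.finite P.1) (𝓝 (Surface.infinite w hw))) (𝓝 L) := by
  obtain ⟨Q₀, hQ₀, hx₀, hy₀⟩ := exists_infinite_eq w hw
  have hy : Q₀.y ≠ 0 := by
    refine (y_ne_zero_iff Q₀).2 ?_
    rw [hx₀]
    exact eval_q_zero_ne_zero h
  obtain ⟨L, hL⟩ := T.exists_tendsto_xValue (π := infinityPatch H) hy
  refine ⟨L, ?_⟩
  have h1 : Tendsto (fun P : H.XDomain =>
      Function.invFun (Surface.ofInfinity H) (Surface.finite P.1))
      (comap (fun P : H.XDomain => Surface.finite P.1) (𝓝 (Surface.infinite w hw)))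
      (comap coords (𝓝 Q₀.coords)) := by
    rw [tendsto_comap_iff]
    exact (Patch.tendsto_coords (π := infinityPatch H) Q₀).comp (hQ₀ ▸ tendsto_comap)
  refine (hL.comp h1).congr' ?_
  have h3 : ∀ᶠ s in 𝓝 (Surface.infinite w hw), s ∈ Set.range (Surface.ofInfinity H) :=
    (Patch.isOpen_range (π := infinityPatch H)).mem_nhds ⟨Q₀, hQ₀.symm⟩
  filter_upwards [tendsto_comap.eventually h3] with P ⟨Q, hQ⟩
  rw [T.pow_mul_atX (X_finite_eq hQ.symm).1 hQ.symm]
  change T.xValue (infinityPatch H) (Surface.ofInfinity H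
    (Function.invFun (Surface.ofInfinity H) (Surface.finite P.1))) = _
  rw [← hQ, Function.leftInverse_invFun Surface.ofInfinity_injective]

theorem isBigO_atX_of_odd (h : Odd H.p.natDegree) :
    (fun P => T.atX P - c / 32 * (P.x ^ 2)⁻¹ * Z) =O[H.xToInfinity] (fun P => (P.x ^ 3)⁻¹) := by
  obtain ⟨C, hC⟩ := T.exists_bound_residue (infinityPatch H) 0
  have hq : H.q.eval 0 = 0 := by
    rw [H.eval_q_zero]
    exact coeff_eq_zero_of_natDegree_lt (by rw [natDegree_eq_of_odd h]; omega)
  -- `q = u r` with `r(0) ≠ 0`, as `q` has a simple zero at `0`. Then `q' ^ 2 / q ^ 2 = u⁻² + r' (2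
  -- r + u r') / (u r ^ 2)`. Multiplied by `u ^ 4 = x ^ (-4)`, the first term is the leading term of
  -- `⟨T(x)⟩` and the second is `O(x ^ (-3))`.
  set r := H.q.divX
  have hqr : H.q = r * X := by
    have := divX_mul_X_add H.q
    rwa [coeff_zero_eq_eval_zero, hq, C_0, add_zero, eq_comm] at this
  have hqe : ∀ u, H.q.eval u = r.eval u * u := fun u => by rw [hqr]; simp
  have hqd : ∀ u, H.q.derivative.eval u = r.derivative.eval u * u + r.eval u := fun u => by
    rw [hqr]; simp
  have hr : r.eval 0 ≠ 0 := by
    have := H.q_regular 0 hq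
    rwa [hqd, mul_zero, zero_add] at this
  have hc : ContinuousAt (fun u : ℂ => ‖c * Z / 32 * (r.derivative.eval u *
      (2 * r.eval u + u * r.derivative.eval u) / r.eval u ^ 2)‖ + ‖(r.eval u)⁻¹‖ * (C / 4)) 0 := by
    have h1 : ContinuousAt (fun u => r.eval u) (0 : ℂ) := r.continuous.continuousAt
    have h2 : ContinuousAt (fun u => r.derivative.eval u) (0 : ℂ) :=
      r.derivative.continuous.continuousAt
    exact (continuousAt_const.mul ((h2.mul ((continuousAt_const.mul h1).add
      (continuousAt_id.mul h2))).div (h1.pow 2) (pow_ne_zero 2 hr))).norm.add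
      ((h1.inv₀ hr).norm.mul continuousAt_const)
  obtain ⟨M, hc'⟩ := hc.exists_eventually_lt
  have hr' : ∀ᶠ u in 𝓝 (0 : ℂ), r.eval u ≠ 0 := r.continuous.continuousAt.eventually_ne hr
  have hev := eventually_xToInfinity (hC.and (tendsto_comap.eventually (hc'.and hr')))
  refine IsBigO.of_bound M (hev.mono ?_)
  rintro P ⟨Q, hQ, hx, hQx, hQy, hR, hb, hQ0⟩
  have h1 := T.pow_mul_atX hx hQ
  have h2 := T.eval_q_mul_xValue Q
  have hu : Q.x ≠ 0 := by rw [hQx]; exact inv_ne_zero hx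
  have hPx : P.x = Q.x⁻¹ := by rw [hQx, inv_inv]
  rw [← h1, hqe, hqd] at h2
  have h3 : T.atX P - c / 32 * (P.x ^ 2)⁻¹ * Z = (P.x ^ 3)⁻¹ * (c * Z / 32 *
      (r.derivative.eval Q.x * (2 * r.eval Q.x + Q.x * r.derivative.eval Q.x) / r.eval Q.x ^ 2) +
        (r.eval Q.x)⁻¹ *
        ((infinityPatch H).residue (c * Z) (T.xValue (infinityPatch H)) Q / 4)) := by
    have h4 : (infinityPatch H).residue (c * Z) (T.xValue (infinityPatch H)) Q / 4 = _ :=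
      (sub_eq_of_eq_add' h2).symm
    rw [h4, hPx]
    field_simp
    ring
  rw [h3, norm_mul, mul_comm]
  refine mul_le_mul_of_nonneg_right (le_trans ?_ hb.le) (norm_nonneg _)
  refine (norm_add_le _ _).trans (add_le_add_right ?_ _)
  rw [norm_mul, norm_div, Complex.norm_ofNat]
  exact mul_le_mul_of_nonneg_left (by linarith [hR hQy]) (norm_nonneg _)

/-- For curves of even degree there is a one-point function with `x ^ 4 ⟨T(x)⟩ → 1`. -/
theorem exists_tendsto_one (h : Even H.p.natDegree) (c Z : ℂ) :
    ∃ T : VirasoroOnePoint H.Surface c Z,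
      Tendsto (fun P : H.XDomain => P.x ^ 4 * T.atX P) H.xToInfinity (𝓝 1) := by
  have hg := H.one_le_g
  have hq := eval_q_zero_ne_zero h
  obtain ⟨K, hK⟩ := H.exists_isAdmissible (c * Z)
  -- The free coefficient of `x ^ (2 g - 2)` in `A` shifts the value of the regular part at `u = 0`;
  -- `α` solves `⟨T(u)⟩ = 1` there. Taking `B = 0` gives the same limit on both sheets.
  set α := 4 * (H.q.eval 0 - c * Z / 32 * (H.q.derivative.eval 0 ^ 2 / H.q.eval 0)) -
    (X ^ 2 * K - H.twist (c * Z)).coeff (2 * H.g)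
  have hA : H.IsAdmissible (c * Z) (K + C α * X ^ (2 * H.g - 2)) := by
    refine hK.add (mem_degreeLT.2 ((degree_C_mul_X_pow_le _ _).trans_lt ?_))
    exact_mod_cast (by omega : 2 * H.g - 2 < 2 * H.g - 1)
  obtain ⟨T, hT⟩ := exists_of_isAdmissible hA (Submodule.zero_mem _)
  refine ⟨T, ?_⟩
  set A := K + C α * X ^ (2 * H.g - 2)
  have hAc : (X ^ 2 * A - H.twist (c * Z)).coeff (2 * H.g) =
      4 * (H.q.eval 0 - c * Z / 32 * (H.q.derivative.eval 0 ^ 2 / H.q.eval 0)) := by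
    obtain ⟨j, hj⟩ : ∃ j, 2 * H.g = j + 2 := ⟨2 * H.g - 2, by omega⟩
    simp only [A, α, hj, Nat.add_sub_cancel, coeff_sub, coeff_add, mul_comm (X ^ 2 : ℂ[X]),
      coeff_mul_X_pow, coeff_C_mul_X_pow, if_true]
    ring
  have h1 := tendsto_eval_div_pow hA
  rw [hAc] at h1
  have h2 : ∀ f : ℂ[X], Tendsto (fun x : ℂ => f.eval x⁻¹) (cocompact ℂ) (𝓝 (f.eval 0)) :=
    fun f => (f.continuous.tendsto 0).comp tendsto_inv_cocompact
  have h3 := (((((h2 (derivative H.q)).pow 2).div (h2 H.q) hq).const_mul (c * Z / 32)).add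
    (h1.div_const 4)).div (h2 H.q) hq
  have h4 : (c * Z / 32 * (H.q.derivative.eval 0 ^ 2 / H.q.eval 0) +
      4 * (H.q.eval 0 - c * Z / 32 * (H.q.derivative.eval 0 ^ 2 / H.q.eval 0)) / 4) /
      H.q.eval 0 = 1 := by
    field_simp
    ring
  rw [h4] at h3
  refine (h3.comp tendsto_comap).congr' ?_
  have hq' : ∀ᶠ u in 𝓝 (0 : ℂ), H.q.eval u ≠ 0 := H.q.continuous.continuousAt.eventually_ne hq
  have hev := eventually_xToInfinity (H := H) (p := fun Q => H.q.eval Q.x ≠ 0)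
    (tendsto_comap.eventually hq')
  refine hev.mono ?_
  rintro P ⟨Q, hQ, hx, hQx, hQy, hQ0⟩
  have h5 := T.eval_q_mul_xValue Q
  rw [← T.pow_mul_atX hx hQ] at h5
  have h6 := residue_infinityPatch (c * Z) hQ P.2 (T.xValue_infinityPatch hx P.2)
  rw [hasGaloisSplitting_iff.1 hT P.1 P.2, ← eval_twist] at h6
  have h7 : (infinityPatch H).residue (c * Z) (T.xValue (infinityPatch H)) Q =
      (X ^ 2 * A - H.twist (c * Z)).eval P.x / P.x ^ (2 * H.g) := by
    rw [eq_div_iff (pow_ne_zero _ hx), mul_comm]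
    refine h6.trans ?_
    simp
    rfl
  rw [h7, hQx] at h5
  rw [hQx] at hQ0
  simp only [Function.comp_apply, Pi.div_apply]
  exact (div_eq_iff hQ0).2 (h5.symm.trans (mul_comm _ _))

end VirasoroOnePoint

/-! ### Leading terms of the Galois-even part and the space of one-point functions -/

namespace HyperellipticEquation

variable {H : HyperellipticEquation} {κ : ℂ} {A : ℂ[X]}

theorem IsAdmissible.coeff_eq_zero (hA : H.IsAdmissible κ A) {k : ℕ}
    (hk : H.p.natDegree - 2 < k) : A.coeff k = 0 := by
  have hg := H.one_le_g
  have h1 := H.natDegree_p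
  rw [hA.coeff_eq (by omega), coeff_eq_zero_of_natDegree_lt (by omega), mul_zero]

theorem IsAdmissible.natDegree_le (hA : H.IsAdmissible κ A) :
    A.natDegree ≤ H.p.natDegree - 2 :=
  natDegree_le_iff_coeff_eq_zero.2 fun _ hk => hA.coeff_eq_zero hk

/-- With `N = 2 g + 2` the leading coefficient is `κ / 8 · N (N - 2 n) a₀`. The integer factor is
`-4 g (g + 1)` for odd `n` and `-4 (g + 1) ^ 2` for even `n`; neither vanishes. -/
theorem IsAdmissible.natDegree_eq (hA : H.IsAdmissible κ A) (hκ : κ ≠ 0) :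
    A.natDegree = H.p.natDegree - 2 := by
  have hg := H.one_le_g
  refine le_antisymm hA.natDegree_le (le_natDegree_of_ne_zero ?_)
  have hp := H.coeff_natDegree_ne_zero
  have hN : ∀ m : ℕ, (m : ℂ) + 1 ≠ 0 := fun m => Nat.cast_add_one_ne_zero m
  rcases H.natDegree_p with h | h
  · rw [h] at hp
    obtain ⟨j, hj⟩ : ∃ j, 2 * H.g + 1 = j + 2 := ⟨2 * H.g + 1 - 2, by omega⟩
    have hj' : (j : ℂ) = 2 * H.g - 1 := by
      have : (2 * H.g + 1 : ℂ) = j + 2 := by exact_mod_cast hj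
      linear_combination -this
    rw [h, hj, Nat.add_sub_cancel, hA.coeff_eq (by omega)]
    rw [hj] at hp
    refine mul_ne_zero (mul_ne_zero (div_ne_zero hκ (by norm_num)) ?_) hp
    have hg0 : (H.g : ℂ) ≠ 0 := Nat.cast_ne_zero.2 (by omega)
    rw [hj', show ((2 * H.g + 2) ^ 2 - 2 * (2 * H.g + 2) * (2 * H.g - 1 + 2) : ℂ) =
      -4 * H.g * (H.g + 1) by ring]
    exact mul_ne_zero (mul_ne_zero (by norm_num) hg0) (hN _)
  · rw [h] at hp
    rw [h, Nat.add_sub_cancel, hA.coeff_eq (by omega)]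
    refine mul_ne_zero (mul_ne_zero (div_ne_zero hκ (by norm_num)) ?_) hp
    push_cast
    rw [show ((2 * H.g + 2) ^ 2 - 2 * (2 * H.g + 2) * (2 * H.g + 2) : ℂ) =
      -4 * (H.g + 1) ^ 2 by ring]
    exact mul_ne_zero (by norm_num) (pow_ne_zero _ (hN _))

theorem IsAdmissible.isBigO (hA : H.IsAdmissible κ A) (h : Even H.p.natDegree) :
    (fun x : ℂ => A.eval x + κ / 8 * (H.p.derivative.eval x ^ 2 / H.p.eval x))
      =O[cocompact ℂ] fun x => x ^ (H.p.natDegree - 4) := by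
  have hg := H.one_le_g
  have hn := natDegree_eq_of_even h
  have hp := H.coeff_natDegree_ne_zero
  -- Completing the square: `x ^ 2 (A + κ / 8 · p' ^ 2 / p) = (x ^ 2 A - twist) + κ / 8 · f ^ 2 /
  -- p`. By Euler's identity for the top term, `f` loses its leading coefficient, so `f ^ 2 / p =
  -- O(x ^ (2 g))`.
  set f : ℂ[X] := X * derivative H.p - C (2 * H.g + 2 : ℂ) * H.p with hf
  have hfd : f.natDegree ≤ 2 * H.g + 1 := by
    rw [natDegree_le_iff_coeff_eq_zero]
    intro k hk
    obtain ⟨j, rfl⟩ : ∃ j, k = j + 1 := ⟨k - 1, by omega⟩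
    rw [hf, coeff_sub, coeff_X_mul, coeff_derivative, coeff_C_mul]
    by_cases hj : j = 2 * H.g + 1
    · rw [hj]
      push_cast
      ring
    · rw [coeff_eq_zero_of_natDegree_lt (by omega)]
      ring
  have hO := isBigO_pow_eval (le_refl H.p.natDegree) hp
  have hinv : (fun x => (H.p.eval x)⁻¹) =O[cocompact ℂ] fun x => (x ^ H.p.natDegree)⁻¹ := by
    refine hO.inv_rev ?_
    filter_upwards [eventually_ne_zero_cocompact] with x hx h0
    exact absurd h0 (pow_ne_zero _ hx)
  have h1 := ((((isBigO_eval hfd).pow 2).mul hinv).const_mul_left (κ / 8)).congr' EventuallyEq.rfl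
    (g₂ := fun x => x ^ (2 * H.g)) (by
      filter_upwards [eventually_ne_zero_cocompact] with x hx
      rw [hn]
      field_simp
      ring)
  have h2 := ((isBigO_eval hA).add h1).mul (isBigO_refl (fun x : ℂ => (x ^ 2)⁻¹) (cocompact ℂ))
  refine h2.congr' ?_ ?_
  · filter_upwards [eventually_ne_zero_cocompact, H.eventually_eval_p_ne_zero] with x hx hpx
    simp only [hf, eval_sub, eval_mul, eval_pow, eval_X, eval_C, eval_twist]
    field_simp
    ring
  · filter_upwards [eventually_ne_zero_cocompact] with x hx
    obtain ⟨j, hj⟩ : ∃ j, 2 * H.g = j + 2 := ⟨2 * H.g - 2, by omega⟩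
    rw [hn, hj, show j + 2 + 2 - 4 = j by omega, pow_add]
    field_simp

/-- For `n = 2 g + 1` the factor `-4 g (g + 1)` in the leading coefficient of `A` is `-(n ^ 2 - 1)`.
-/
theorem IsAdmissible.coeff_add_eq_zero (hA : H.IsAdmissible κ A) (h : Odd H.p.natDegree) {k : ℕ}
    (hk : H.p.natDegree - 3 < k) :
    (A + C (κ / 8 * ((H.p.natDegree : ℂ) ^ 2 - 1) * H.p.coeff H.p.natDegree) *
      X ^ (H.p.natDegree - 2)).coeff k = 0 := by
  have hg := H.one_le_g
  have hn := natDegree_eq_of_odd h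
  rw [coeff_add, coeff_C_mul_X_pow]
  by_cases hk' : k = H.p.natDegree - 2
  · have hj : H.p.natDegree = k + 2 := by omega
    have hj' : (k : ℂ) = 2 * H.g - 1 := by
      have : (2 * H.g + 1 : ℂ) = k + 2 := by exact_mod_cast hn.symm.trans hj
      linear_combination -this
    rw [if_pos hk', hA.coeff_eq (by omega), hj]
    push_cast
    rw [hj']
    ring
  · rw [if_neg hk', hA.coeff_eq_zero (by omega), add_zero]

variable (H) in
/-- The linear parametrization of the differences of one-point functions. -/
def regularPart : (degreeLT ℂ (2 * H.g - 1) × degreeLT ℂ (H.g - 2)) →ₗ[ℂ] (H.XDomain → ℂ) where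
  toFun v P := (v.1.1.eval P.x + P.y * v.2.1.eval P.x) / (4 * H.p.eval P.x)
  map_add' v w := by
    funext P
    simp only [Prod.fst_add, Prod.snd_add, Submodule.coe_add, eval_add, Pi.add_apply]
    ring
  map_smul' a v := by
    funext P
    simp only [Prod.smul_fst, Prod.smul_snd, Submodule.coe_smul, eval_smul, smul_eq_mul,
      Pi.smul_apply, RingHom.id_apply]
    ring

theorem XDomain.eval_ne_zero (P : H.XDomain) : H.p.eval P.x ≠ 0 :=
  Patch.eval_ne_zero (π := finitePatch H) (P := P.1) P.2

/-- Evaluating at a point and its conjugate separates `A` from `B`; a polynomial that vanishes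
wherever `p ≠ 0` is zero. -/
theorem regularPart_injective : Function.Injective H.regularPart := by
  rw [← LinearMap.ker_eq_bot, LinearMap.ker_eq_bot']
  rintro ⟨⟨A, hA⟩, ⟨B, hB⟩⟩ h
  have hp0 : H.p ≠ 0 := fun h0 => H.coeff_natDegree_ne_zero (by simp [h0])
  have h1 : ∀ P : AffineCurve H.p, P.y ≠ 0 → A.eval P.x + P.y * B.eval P.x = 0 := by
    intro P hy
    have h2 := congrFun h ⟨P, hy⟩
    have h3 : H.p.eval P.x ≠ 0 := Patch.eval_ne_zero (π := finitePatch H) hy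
    exact (div_eq_zero_iff.1 h2).resolve_right (mul_ne_zero (by norm_num) h3)
  have h2 : ∀ x, H.p.eval x ≠ 0 → A.eval x = 0 ∧ B.eval x = 0 := by
    intro x hx
    have hy : (AffineCurve.lift H.p x).y ≠ 0 := (AffineCurve.y_ne_zero_iff _).2 hx
    have e1 : A.eval x + (AffineCurve.lift H.p x).y * B.eval x = 0 := h1 _ hy
    have e2 : A.eval x + -(AffineCurve.lift H.p x).y * B.eval x = 0 :=
      h1 (AffineCurve.lift H.p x).conj (neg_ne_zero.2 hy)
    have e3 : 2 * (AffineCurve.lift H.p x).y * B.eval x = 0 := by linear_combination e1 - e2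
    refine ⟨by linear_combination (e1 + e2) / 2,
      (mul_eq_zero.1 e3).resolve_left (mul_ne_zero two_ne_zero hy)⟩
  have h3 : ∀ f : ℂ[X], (∀ x, H.p.eval x ≠ 0 → f.eval x = 0) → f = 0 := by
    intro f hf
    have h4 : H.p * f = 0 := Polynomial.funext fun x => by
      by_cases hx : H.p.eval x = 0
      · simp [hx]
      · simp [hf x hx]
    exact (mul_eq_zero.1 h4).resolve_left hp0
  obtain rfl := h3 A fun x hx => (h2 x hx).1
  obtain rfl := h3 B fun x hx => (h2 x hx).2
  rfl

end HyperellipticEquation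

theorem Polynomial.finrank_degreeLT (n : ℕ) : Module.finrank ℂ (degreeLT ℂ n) = n := by
  rw [(degreeLTEquiv ℂ n).finrank_eq, Module.finrank_fin_fun]

namespace VirasoroOnePoint

open HyperellipticEquation

variable {H : HyperellipticEquation} {c Z : ℂ}

/-- The polar part depends only on `c` and `Z`, so it cancels in the difference of two one-point
functions. -/
theorem HasGaloisSplitting.atX_eq_add {T T₀ : VirasoroOnePoint H.Surface c Z} {A B A₀ : ℂ[X]}
    (h : T.HasGaloisSplitting A B) (h₀ : T₀.HasGaloisSplitting A₀ 0) (P : H.XDomain) :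
    T.atX P = ((A - A₀).eval P.x + P.y * B.eval P.x) / (4 * H.p.eval P.x) + T₀.atX P := by
  have hp := P.eval_ne_zero
  have h1 := h P
  have h2 := h₀ P
  rw [eval_zero, mul_zero, add_zero] at h2
  refine mul_left_cancel₀ hp ?_
  rw [mul_add, h1, h2, eval_sub]
  field_simp
  ring

/-- The one-point functions form an affine space. -/
theorem exists_affineSubspace (hg : 2 ≤ H.g) (c Z : ℂ) :
    ∃ W : AffineSubspace ℂ (H.XDomain → ℂ),
      (W : Set (H.XDomain → ℂ)) =
        Set.range (fun T : VirasoroOnePoint H.Surface c Z => T.atX) ∧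
      (W : Set (H.XDomain → ℂ)).Nonempty ∧
      Module.finrank ℂ W.direction = 3 * (H.g - 1) := by
  obtain ⟨K, hK⟩ := H.exists_isAdmissible (c * Z)
  obtain ⟨T₀, hT₀⟩ := exists_of_isAdmissible hK (Submodule.zero_mem _)
  refine ⟨AffineSubspace.mk' T₀.atX (LinearMap.range H.regularPart), ?_,
    AffineSubspace.mk'_nonempty _ _, ?_⟩
  · ext F
    rw [SetLike.mem_coe, AffineSubspace.mem_mk', vsub_eq_sub]
    constructor
    · rintro ⟨v, hv⟩
      obtain ⟨T, hT⟩ := exists_of_isAdmissible (hK.add v.1.2) v.2.2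
      refine ⟨T, funext fun P => ?_⟩
      have h1 := congrFun hv P
      rw [Pi.sub_apply, eq_sub_iff_add_eq] at h1
      refine (hT.atX_eq_add hT₀ P).trans (Eq.trans ?_ h1)
      rw [add_sub_cancel_left]
      rfl
    · rintro ⟨T, rfl⟩
      obtain ⟨A, B, hT, hA, hB⟩ := T.exists_splitting
      refine ⟨(⟨A - K, hA.sub_mem hK⟩, ⟨B, hB⟩), funext fun P => ?_⟩
      rw [Pi.sub_apply, eq_sub_iff_add_eq]
      exact (hT.atX_eq_add hT₀ P).symm
  · rw [AffineSubspace.direction_mk', LinearMap.finrank_range_of_inj regularPart_injective,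
      Module.finrank_prod, finrank_degreeLT, finrank_degreeLT]
    -- `(2 g - 1) + (g - 2) = 3 (g - 1)`; the truncated `g - 2` is where `2 ≤ g` enters.
    omega

end VirasoroOnePoint

end

theorem theorem1 (H : HyperellipticEquation) (n : ℕ) (hn : n = H.p.natDegree) (c Z : ℂ) :
    -- Behaviour of the one-point function as `x → ∞`.
    (∀ T : VirasoroOnePoint H.Surface c Z,
      (Even n →
        T.atX =O[H.xToInfinity] (fun P => (P.x ^ 4)⁻¹) ∧
        ∀ w hw, ∃ L : ℂ, Tendsto (fun P : H.XDomain => P.x ^ 4 * T.atX P)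
          (comap (fun P : H.XDomain => HyperellipticEquation.Surface.finite P.1)
            (𝓝 (HyperellipticEquation.Surface.infinite w hw))) (𝓝 L)) ∧
      (Odd n →
        (fun P => T.atX P - c / 32 * (P.x ^ 2)⁻¹ * Z) =O[H.xToInfinity]
          (fun P => (P.x ^ 3)⁻¹))) ∧
    -- The exponent `-4` is optimal.
    (Even n → ∃ T : VirasoroOnePoint H.Surface c Z,
      ∀ w hw, ∃ L : ℂ, L ≠ 0 ∧ Tendsto (fun P : H.XDomain => P.x ^ 4 * T.atX P)
        (comap (fun P : H.XDomain => HyperellipticEquation.Surface.finite P.1)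
          (𝓝 (HyperellipticEquation.Surface.infinite w hw))) (𝓝 L)) ∧
    -- The polynomial `P(x, y) = A(x) + y B(x)`.
    (∀ T : VirasoroOnePoint H.Surface c Z, ∃ A B : ℂ[X],
      T.HasGaloisSplitting A B ∧
      A.natDegree ≤ n - 2 ∧
      (c * Z ≠ 0 → A.natDegree = n - 2) ∧
      (Even n →
        (fun x : ℂ => A.eval x + c / 8 * (H.p.derivative.eval x ^ 2 / H.p.eval x) * Z)
          =O[cocompact ℂ] (fun x => x ^ (n - 4))) ∧
      (Odd n → ∀ k > n - 3,
        (A + C (c / 8 * ((n : ℂ) ^ 2 - 1) * H.p.coeff n * Z) * X ^ (n - 2)).coeff k = 0) ∧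
      (3 ≤ H.g → Even n → B.natDegree ≤ n / 2 - 4) ∧
      (3 ≤ H.g → Odd n → B.natDegree ≤ (n - 1) / 2 - 3) ∧
      (H.g ≤ 2 → B = 0)) ∧
    -- The degree bounds for the Galois-odd part are optimal.
    (3 ≤ H.g → ∃ (T : VirasoroOnePoint H.Surface c Z) (A B : ℂ[X]),
      T.HasGaloisSplitting A B ∧
      (Even n → B.degree = ((n / 2 - 4 : ℕ) : WithBot ℕ)) ∧
      (Odd n → B.degree = (((n - 1) / 2 - 3 : ℕ) : WithBot ℕ))) ∧
    -- The dimension of the space of one-point functions.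
    (2 ≤ H.g → ∃ W : AffineSubspace ℂ (H.XDomain → ℂ),
      (W : Set (H.XDomain → ℂ)) =
        Set.range (fun T : VirasoroOnePoint H.Surface c Z => T.atX) ∧
      (W : Set (H.XDomain → ℂ)).Nonempty ∧
      Module.finrank ℂ W.direction = 3 * (H.g - 1)) := by
  subst hn
  refine ⟨fun T => ⟨fun h => ⟨T.isBigO_atX_of_even h, T.exists_tendsto_pow_mul_atX h⟩,
    T.isBigO_atX_of_odd⟩, fun h => ?_, fun T => ?_, fun hg => ?_,
    fun hg => VirasoroOnePoint.exists_affineSubspace hg c Z⟩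
  · obtain ⟨T, hT⟩ := VirasoroOnePoint.exists_tendsto_one h c Z
    exact ⟨T, fun w hw => ⟨1, one_ne_zero,
      hT.mono_left (HyperellipticEquation.comap_nhds_infinite_le w hw)⟩⟩
  · obtain ⟨A, B, hAB, hA, hB⟩ := T.exists_splitting
    have hBd : 3 ≤ H.g → B.natDegree ≤ H.g - 3 := fun hg =>
      natDegree_le_iff_coeff_eq_zero.2 fun k hk =>
        (degree_lt_iff_coeff_zero _ _).1 (mem_degreeLT.1 hB) k (by omega)
    refine ⟨A, B, hAB, hA.natDegree_le, hA.natDegree_eq, fun h => ?_, fun h k hk => ?_,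
      fun hg h => ?_, fun hg h => ?_, fun hg => ?_⟩
    · refine (hA.isBigO h).congr_left fun x => ?_
      ring
    · have e : c / 8 * ((H.p.natDegree : ℂ) ^ 2 - 1) * H.p.coeff H.p.natDegree * Z =
          c * Z / 8 * ((H.p.natDegree : ℂ) ^ 2 - 1) * H.p.coeff H.p.natDegree := by ring
      rw [e]
      exact hA.coeff_add_eq_zero h hk
    · have := hBd hg
      have := HyperellipticEquation.natDegree_eq_of_even h
      omega
    · have := hBd hg
      have := HyperellipticEquation.natDegree_eq_of_odd h
      omega
    · rw [mem_degreeLT, show H.g - 2 = 0 by omega] at hB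
      exact degree_eq_bot.1 (by simpa using hB)
  · obtain ⟨K, hK⟩ := H.exists_isAdmissible (c * Z)
    -- The odd part is unconstrained below degree `g - 2`, so its top monomial attains the bound;
    -- both `n / 2 - 4` and `(n - 1) / 2 - 3` equal `g - 3` in their parity.
    have hB : (X ^ (H.g - 3) : ℂ[X]) ∈ degreeLT ℂ (H.g - 2) := by
      rw [mem_degreeLT, degree_X_pow]
      exact_mod_cast (by omega : H.g - 3 < H.g - 2)
    obtain ⟨T, hT⟩ := VirasoroOnePoint.exists_of_isAdmissible hK hB
    refine ⟨T, K, X ^ (H.g - 3), hT, fun h => ?_, fun h => ?_⟩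
    · have := HyperellipticEquation.natDegree_eq_of_even h
      rw [degree_X_pow, show H.p.natDegree / 2 - 4 = H.g - 3 by omega]
    · have := HyperellipticEquation.natDegree_eq_of_odd h
      rw [degree_X_pow, show (H.p.natDegree - 1) / 2 - 3 = H.g - 3 by omega]
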